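/- Let $d\ge 0$ and $n\ge 2$ be integers, $X_n=\{0,\dots,n-1\}$, let $\mathfrak C_n=X_n^{\omega}$ be the Cantor space of infinite words, and let $(X_n^*)^d$ be the monoid of $d$-tuples of finite words with coordinatewise concatenation. For $w\in (X_n^*)^d$ write $w\mathfrak C_n^d$ for the set of points of $\mathfrak C_n^d$ having $w$ as a coordinatewise prefix. Coordinates are numbered $0,\dots,d-1$ and $\pi_i$ denotes the $i$-th coordinate. Products of homeomorphisms are read from left to right ($fg$ means first $f$, then $g$). A *$(d,n)$-transducer* $T$ is a set $Q_T$ of states with a right monoid action $(q,w)\mapsto q\cdot w$ of $(X_n^*)^d$ on $Q_T$ and an output function $\lambda_T:Q_T\times (X_n^*)^d\to (X_n^*)^d$ such that $\lambda_T(q,st)=\lambda_T(q,s)\,\lambda_T(q\cdot s,t)$. A *strong isomorphism* $T\cong_S T'$ is a bijection of the state sets which respects actions and output functions; $[T]$ denotes the strong isomorphism class. The *minimal transducer* of $T$ is obtained by identifying states $p,q$ with $\lambda_T(p,\cdot)=\lambda_T(q,\cdot)$. $T$ is *synchronizing* if there is $k$ such that $p\cdot w=q\cdot w$ for all states $p,q$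 and all $w$ all of whose coordinates have length at least $k$. Its *core* $\operatorname{Core}(T)$ is the restriction of $T$ to the states $q$ for which there is a $w$ with $p\cdot w=q$ for all states $p$. For a homeomorphism $h$ of $\mathfrak C_n^d$ let $\ell_i(s)$ be the longest common prefix of the $i$-th coordinates of the points of $(s\mathfrak C_n^d)h$. Let $T_h$ be the $(d,n)$-transducer with state set $(X_n^*)^d$, action $s\cdot t=st$, and output $\lambda(s,t)$ whose $i$-th coordinate is $\ell_i(st)$ with its prefix $\ell_i(s)$ removed. Let $M_h$ be the minimal transducer of $T_h$. Let $d\mathcal S_{n,1}$ be the set of those $h$ for which $M_h$ is synchronizing, let $d\mathcal B_{n,1}$ be the set of those $h\in d\mathcal S_{n,1}$ with $h^{-1}\in d\mathcal S_{n,1}$, and let $d\mathcal O_{n,1}=\{[\operatorname{Core}(M_f)] : f\in d\mathcal B_{n,1}\}$. Then: 1. $d\mathcal S_{n,1}$ is closed under composition, so that $d\mathcal B_{n,1}$ is its group of units, and $[\operatorname{Core}(M_f)][\operatorname{Core}(M_g)]=[\operatorname{Core}(M_{fg})]$ ($f,g\in d\mathcal B_{n,1}$) is a well-defined group multiplication on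 $d\mathcal O_{n,1}$. 2. For every $T$ with $[T]\in d\mathcal O_{n,1}$ there is a unique map $\psi_T:\{0,\dots,d-1\}\to\{0,\dots,d-1\}$ such that, for every coordinate $i$, every state $q$ and every word $l$ which is empty in all coordinates other than $i$, the word $\lambda_T(q,l)$ is empty in all coordinates other than $\psi_T(i)$. 3. The set $d\mathcal K_{n,1}=\{[T]\in d\mathcal O_{n,1} : \psi_T=\mathrm{id}\}$ is a subgroup of $d\mathcal O_{n,1}$, the symmetric group $S_d$ acts on it by automorphisms through permutation of the coordinates, $\sigma\cdot[T]=[T^{\sigma}]$, where $T^\sigma$ is $T$ with the $i$-th coordinate of input and output renamed $\sigma(i)$, and for this action $$d\mathcal O_{n,1}\;\cong\; d\mathcal K_{n,1}\rtimes S_d ,$$ by an isomorphism which is the inclusion on $d\mathcal K_{n,1}$ and which maps $\sigma\in S_d$ to $[\operatorname{Core}(M_{h_\sigma})]$, where $h_\sigma\in d\mathcal B_{n,1}$ is the homeomorphism $(p_0,\dots,p_{d-1})\mapsto (p_{\sigma(0)},\dots,p_{\sigma(d-1)})$. (Here permutations are multiplied as functions, $(\sigma\tau)(i)=\sigma(\tau(i))$.)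 -/

import Mathlib

namespace BrinThompson

/-- A transducer with domain semigroup `D` and range semigroup `R`. -/
structure Transducer (D R : Type) [Semigroup D] [Semigroup R] where
  /-- the set of states -/
  State : Type
  /-- the transition function, a right action of `D` on the states -/
  trans : State → D → State
  /-- the output function -/
  out : State → D → R
  trans_mul : ∀ q s t, trans q (s * t) = trans (trans q s) t
  out_mul : ∀ q s t, out q (s * t) = out q s * out (trans q s) t

/-- `d`-tuples of finite words over the alphabet `{0, …, n-1}`, with coordinatewise concatenation. -/
abbrev Words (d n : ℕ) : Type := Fin d → FreeMonoid (Fin n)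

/-- The space `𝔠ₙᵈ` of `d`-tuples of infinite words, with the product topology. -/
abbrev Cantor (d n : ℕ) : Type := Fin d → ℕ → Fin n

/-- A `(d, n)`-transducer: domain and range are `(Xₙ*)ᵈ`, and the transition function is a monoid
action. -/
structure DNTransducer (d n : ℕ) extends Transducer (Words d n) (Words d n) where
  trans_one : ∀ q, trans q 1 = q

namespace DNTransducer

variable {d n : ℕ}

/-- A strong isomorphism: a bijection of the states compatible with transitions and outputs, the
domain and the range being mapped identically. -/
structure StrongIso (A B : DNTransducer d n) where
  toEquiv : A.State ≃ B.State
  map_trans : ∀ q s, toEquiv (A.trans q s) = B.trans (toEquiv q) s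
  map_out : ∀ q s, A.out q s = B.out (toEquiv q) s

/-- Strong isomorphism as an equivalence relation. -/
def strongIsoSetoid (d n : ℕ) : Setoid (DNTransducer d n) where
  r A B := Nonempty (StrongIso A B)
  iseqv :=
    { refl := fun _ => ⟨⟨Equiv.refl _, fun _ _ => rfl, fun _ _ => rfl⟩⟩
      symm := fun ⟨e⟩ => ⟨⟨e.toEquiv.symm,
        fun q s => by
          rw [Equiv.symm_apply_eq, e.map_trans, Equiv.apply_symm_apply],
        fun q s => by rw [e.map_out, Equiv.apply_symm_apply]⟩⟩
      trans := fun ⟨e⟩ ⟨f⟩ => ⟨⟨e.toEquiv.trans f.toEquiv,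
        fun q s => by simp [e.map_trans, f.map_trans],
        fun q s => by simp [e.map_out, f.map_out]⟩⟩ }

/-- Two states are equivalent if they have the same output function. -/
def stateSetoid (T : DNTransducer d n) : Setoid T.State where
  r p q := ∀ s, T.out p s = T.out q s
  iseqv :=
    { refl := fun _ _ => rfl
      symm := fun h s => (h s).symm
      trans := fun h k s => (h s).trans (k s) }

/-- The minimal transducer `M_T`, obtained by identifying equivalent states. -/
def minimal (T : DNTransducer d n) : DNTransducer d n where
  State := Quotient T.stateSetoid
  trans q s := Quotient.map (sa := T.stateSetoid) (sb := T.stateSetoid) (fun p => T.trans p s)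
    (fun p p' h t => by
      have h1 := h (s * t)
      rw [T.out_mul, T.out_mul, h s] at h1
      exact mul_left_cancel h1) q
  out q s := Quotient.lift (s := T.stateSetoid) (fun p => T.out p s) (fun _ _ h => h s) q
  trans_mul q s t := by
    induction q using Quotient.inductionOn with
    | h p => exact congrArg (Quotient.mk T.stateSetoid) (T.trans_mul p s t)
  out_mul q s t := by
    induction q using Quotient.inductionOn with
    | h p => exact T.out_mul p s t
  trans_one q := by
    induction q using Quotient.inductionOn with
    | h p => exact congrArg (Quotient.mk T.stateSetoid) (T.trans_one p)

/-- `T` is synchronizing at level `k`: the state reached by reading a word that is of length at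
least `k` in every coordinate does not depend on the initial state. -/
def SyncAt (T : DNTransducer d n) (k : ℕ) : Prop :=
  ∀ (p q : T.State) (w : Words d n), (∀ i, k ≤ (w i).length) → T.trans p w = T.trans q w

/-- `T` is synchronizing at some level. -/
def Synchronizing (T : DNTransducer d n) : Prop := ∃ k, T.SyncAt k

/-- The states of the core: those `q` such that some word leads to `q` from every state. -/
def coreStates (T : DNTransducer d n) : Set T.State :=
  {q | ∃ w : Words d n, ∀ p, T.trans p w = q}

/-- The core of `T`, with the restrictions of the transition and output functions. -/
def core (T : DNTransducer d n) : DNTransducer d n where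
  State := T.coreStates
  trans q s := ⟨T.trans q.1 s, by
    obtain ⟨w, hw⟩ := q.2
    exact ⟨w * s, fun p => by rw [T.trans_mul, hw]⟩⟩
  out q s := T.out q.1 s
  trans_mul q s t := Subtype.ext (T.trans_mul q.1 s t)
  out_mul q s t := T.out_mul q.1 s t
  trans_one q := Subtype.ext (T.trans_one q.1)

/-- The words that are empty in every coordinate outside `S`. -/
def wordsOn (d n : ℕ) (S : Set (Fin d)) : Set (Words d n) := {w | ∀ i, i ∉ S → w i = 1}

/-- From every state, reading in coordinate `i` only writes in coordinate `ψ i`. -/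
def IsCoordMap (T : DNTransducer d n) (ψ : Fin d → Fin d) : Prop :=
  ∀ (i : Fin d) (q : T.State), ∀ l ∈ wordsOn d n {i}, T.out q l ∈ wordsOn d n {ψ i}

/-- The map `ψ_T`: the function `ψ` with `T.IsCoordMap ψ`, when there is exactly one. -/
noncomputable def coordMap (T : DNTransducer d n) : Fin d → Fin d :=
  @Classical.epsilon _ ⟨id⟩ T.IsCoordMap

/-- Relabelling of the coordinates of input and output by a permutation: the `i`-th coordinate of
`T` becomes the `σ i`-th coordinate of `T.permute σ`. -/
def permute (σ : Equiv.Perm (Fin d)) (T : DNTransducer d n) : DNTransducer d n where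
  State := T.State
  trans q w := T.trans q (w ∘ σ)
  out q w := T.out q (w ∘ σ) ∘ σ.symm
  trans_mul q s t := T.trans_mul q (s ∘ σ) (t ∘ σ)
  out_mul q s t := congrArg (· ∘ σ.symm) (T.out_mul q (s ∘ σ) (t ∘ σ))
  trans_one q := T.trans_one q

end DNTransducer

/-! ### The transducer of a homeomorphism -/

section Homeo

variable {d n : ℕ}

/-- The finite word `w` is a prefix of the infinite word `x`. -/
def IsPrefixOf (w : FreeMonoid (Fin n)) (x : ℕ → Fin n) : Prop :=
  ∀ (j : ℕ) (hj : j < w.toList.length), w.toList[j] = x j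

/-- The cone of all points with prefix `w`. -/
def cone (w : Words d n) : Set (Cantor d n) := {x | ∀ i, IsPrefixOf (w i) (x i)}

/-- `w` is the longest common prefix of the words in `S`. -/
def IsLCP (w : FreeMonoid (Fin n)) (S : Set (ℕ → Fin n)) : Prop :=
  (∀ x ∈ S, IsPrefixOf w x) ∧
    ∀ v : FreeMonoid (Fin n), (∀ x ∈ S, IsPrefixOf v x) → v.toList <+: w.toList

open Classical in
/-- The longest common prefix of a set of infinite words (the empty word if there is none). -/
noncomputable def lcp (S : Set (ℕ → Fin n)) : FreeMonoid (Fin n) :=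
  if h : ∃ w, IsLCP w S then h.choose else 1

theorem isLCP_lcp {S : Set (ℕ → Fin n)} (hS : S.Nontrivial) : IsLCP (lcp S) S := by
  classical
  suffices h : ∃ w, IsLCP w S by
    unfold lcp
    rw [dif_pos h]
    exact h.choose_spec
  obtain ⟨x, hx, y, hy, hxy⟩ := hS
  obtain ⟨m, hm⟩ := Function.ne_iff.mp hxy
  let P : ℕ → Prop := fun k => ∀ z ∈ S, ∀ j < k, z j = x j
  have hbound : ∀ k, P k → k ≤ m := by
    intro k hk
    by_contra hlt
    exact hm (hk y hy m (by omega)).symm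
  have hP : P (Nat.findGreatest P m) :=
    Nat.findGreatest_spec (P := P) (Nat.zero_le m) (by intro z _ j hj; omega)
  refine ⟨FreeMonoid.ofList ((List.range (Nat.findGreatest P m)).map x), ?_, ?_⟩
  · intro z hz j hj
    simp only [FreeMonoid.toList_ofList, List.length_map, List.length_range] at hj
    simpa using (hP z hz j hj).symm
  · intro v hv
    have hPv : P v.toList.length := by
      intro z hz j hj
      rw [← hv z hz j hj, ← hv x hx j hj]
    have hle := Nat.le_findGreatest (hbound _ hPv) hPv
    rw [FreeMonoid.toList_ofList, List.prefix_iff_getElem]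
    refine ⟨by simpa using hle, fun j hj => ?_⟩
    simpa using hv x hx j hj

theorem lcp_prefix_of_subset {S S' : Set (ℕ → Fin n)} (hS : S.Nontrivial) (h : S ⊆ S') :
    (lcp S').toList <+: (lcp S).toList :=
  (isLCP_lcp hS).2 _ fun x hx => (isLCP_lcp (hS.mono h)).1 x (h hx)

theorem isOpen_cone (w : Words d n) : IsOpen (cone w) := by
  have : cone w = ⋂ i : Fin d, ⋂ j : Fin (w i).toList.length,
      {x : Cantor d n | (w i).toList[j] = x i j} := by
    ext x
    simp only [cone, IsPrefixOf, Set.mem_ofPred_eq, Set.mem_iInter]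
    exact ⟨fun h i j => h i j j.2, fun h i j hj => h i ⟨j, hj⟩⟩
  rw [this]
  refine isOpen_iInter_of_finite fun i => isOpen_iInter_of_finite fun j => ?_
  have hc : Continuous fun x : Cantor d n => x i j := by fun_prop
  exact (isOpen_discrete {a : Fin n | (w i).toList[j] = a}).preimage hc

theorem cone_nonempty [n.AtLeastTwo] (w : Words d n) : (cone w).Nonempty := by
  have hn : 0 < n := lt_of_lt_of_le two_pos (Nat.AtLeastTwo.prop (n := n))
  refine ⟨fun i j => (w i).toList.getD j ⟨0, hn⟩, fun i j hj => ?_⟩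
  simp [hj]

theorem nontrivial_of_isOpen [n.AtLeastTwo] {S : Set (ℕ → Fin n)} (hS : IsOpen S)
    (hne : S.Nonempty) : S.Nontrivial := by
  obtain ⟨x, hx⟩ := hne
  obtain ⟨I, u, hu, hsub⟩ := isOpen_pi_iff.mp hS x hx
  obtain ⟨N, hN⟩ := Infinite.exists_notMem_finset I
  have : Nontrivial (Fin n) := Fin.nontrivial_iff_two_le.mpr Nat.AtLeastTwo.prop
  obtain ⟨a, ha⟩ := exists_ne (x N)
  refine ⟨Function.update x N a, hsub fun j hj => ?_, x, hx, fun h => ha ?_⟩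
  · have hjN : j ≠ N := fun h => hN (h ▸ hj)
    rw [Function.update_of_ne hjN]
    exact (hu j hj).2
  · simpa using congrFun h N

/-- The set of the `i`-th coordinates of the images under `h` of the points of the cone of `s`. -/
def coordImage (h : Cantor d n ≃ₜ Cantor d n) (s : Words d n) (i : Fin d) : Set (ℕ → Fin n) :=
  (fun x : Cantor d n => x i) '' (h '' cone s)

theorem coordImage_nontrivial [n.AtLeastTwo] (h : Cantor d n ≃ₜ Cantor d n) (s : Words d n)
    (i : Fin d) : (coordImage h s i).Nontrivial :=
  nontrivial_of_isOpen (isOpenMap_eval i _ (h.isOpenMap _ (isOpen_cone s)))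
    (((cone_nonempty s).image _).image _)

theorem cone_mul_subset (s t : Words d n) : cone (s * t) ⊆ cone s := by
  intro x hx i j hj
  have hlen : ((s * t) i).toList = (s i).toList ++ (t i).toList := rfl
  have h2 : j < ((s * t) i).toList.length := by
    rw [hlen, List.length_append]
    omega
  rw [← hx i j h2]
  simp only [hlen]
  rw [List.getElem_append_left hj]

theorem coordImage_mul_subset (h : Cantor d n ≃ₜ Cantor d n) (s t : Words d n) (i : Fin d) :
    coordImage h (s * t) i ⊆ coordImage h s i :=
  Set.image_mono (Set.image_mono (cone_mul_subset s t))

/-- The difference `b - a`: the word `b` with its prefix `a` removed. -/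
def wordSub {α : Type} (b a : FreeMonoid α) : FreeMonoid α :=
  FreeMonoid.ofList (b.toList.drop a.toList.length)

theorem wordSub_mul {α : Type} {a b c : FreeMonoid α} (hab : a.toList <+: b.toList)
    (hbc : b.toList <+: c.toList) : wordSub c a = wordSub b a * wordSub c b := by
  obtain ⟨u, hu⟩ := hab
  obtain ⟨v, hv⟩ := hbc
  apply FreeMonoid.toList.injective
  simp only [wordSub, FreeMonoid.toList_ofList, FreeMonoid.toList_mul]
  rw [← hv, ← hu]
  simp only [List.append_assoc, List.drop_left]
  rw [← List.append_assoc, List.drop_left]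

/-- The transducer `T_h` of a homeomorphism `h`. -/
noncomputable def homeoTransducer [n.AtLeastTwo] (h : Cantor d n ≃ₜ Cantor d n) :
    DNTransducer d n where
  State := Words d n
  trans s t := s * t
  out s t i := wordSub (lcp (coordImage h (s * t) i)) (lcp (coordImage h s i))
  trans_mul s t u := (mul_assoc s t u).symm
  out_mul s t u := by
    funext i
    rw [Pi.mul_apply, ← mul_assoc]
    exact wordSub_mul
      (lcp_prefix_of_subset (coordImage_nontrivial h _ i) (coordImage_mul_subset h s t i))
      (lcp_prefix_of_subset (coordImage_nontrivial h _ i) (coordImage_mul_subset h (s * t) u i))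
  trans_one s := mul_one s

/-- `M_h`, the minimal transducer of `T_h`. -/
noncomputable def minTransducer [n.AtLeastTwo] (h : Cantor d n ≃ₜ Cantor d n) :
    DNTransducer d n :=
  (homeoTransducer h).minimal

/-- The strong isomorphism class of the core of `M_h`. -/
noncomputable def coreClass [n.AtLeastTwo] (h : Cantor d n ≃ₜ Cantor d n) :
    Quotient (DNTransducer.strongIsoSetoid d n) :=
  Quotient.mk _ (minTransducer h).core

/-- The homeomorphism `(p_0, …, p_{d-1}) ↦ (p_{σ 0}, …, p_{σ (d-1)})`. -/
def permHomeo (n : ℕ) (σ : Equiv.Perm (Fin d)) : Cantor d n ≃ₜ Cantor d n where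
  toFun p := p ∘ σ
  invFun p := p ∘ σ.symm
  left_inv p := by
    funext i
    simp
  right_inv p := by
    funext i
    simp
  continuous_toFun := continuous_pi fun i => continuous_apply (σ i)
  continuous_invFun := continuous_pi fun i => continuous_apply (σ.symm i)

end Homeo

/-- `d𝒮_{n,1}`: the synchronizing homeomorphisms. -/
def syncHomeos (d n : ℕ) [n.AtLeastTwo] : Set (Cantor d n ≃ₜ Cantor d n) :=
  {f | (minTransducer f).Synchronizing}

/-- `dℬ_{n,1}`: the elements of `d𝒮_{n,1}` which are invertible in `d𝒮_{n,1}`. -/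
def unitHomeos (d n : ℕ) [n.AtLeastTwo] : Set (Cantor d n ≃ₜ Cantor d n) :=
  {f | f ∈ syncHomeos d n ∧ ∃ g ∈ syncHomeos d n,
    f.trans g = Homeomorph.refl _ ∧ g.trans f = Homeomorph.refl _}

/-- The underlying set of `d𝒪_{n,1}`: the classes of `Core(M_f)` with `f ∈ dℬ_{n,1}`. -/
def outerClasses (d n : ℕ) [n.AtLeastTwo] : Set (Quotient (DNTransducer.strongIsoSetoid d n)) :=
  {c | ∃ f ∈ unitHomeos d n, c = coreClass f}

/-- The underlying set of `d𝒦_{n,1}`: the classes `[T] ∈ d𝒪_{n,1}` with `ψ_T = id`. -/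
def coordIdClasses (d n : ℕ) [n.AtLeastTwo] : Set (Quotient (DNTransducer.strongIsoSetoid d n)) :=
  {c | c ∈ outerClasses d n ∧ ∃ T : DNTransducer d n, Quotient.mk _ T = c ∧ T.coordMap = id}

end BrinThompson

/-! Everything is expressed through local maps. On the cone of `s`, a homeomorphism factors as `h (s
x) = P (h_s x)`, where `P = imagePrefix h s` and `h_s = localMap h s` has no common prefix left to
remove. States of `M_h` correspond to local maps, because the local map and the output function
determine each other (`output_congr`, `localMap_eq_of_output_eq`). So `h` is synchronizing exactly
when `localMap h s` depends only on the last `k` letters of `s` in each coordinate, for long `s`.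
Composition preserves this because, by compactness, long inputs give long outputs. The core is
determined by its set of output functions, `coreOut`, and the `coreOut` of a product depends only on
those of its factors.

The coordinate map rests on one finiteness fact, `SyncLocal.finite_imagePrefix_le`. There are
finitely many local maps at deep words, and the pair (`imagePrefix`, `localMap`) determines the word
by injectivity of `h`; so only finitely many deep words have image prefixes under a given bound.
Applied to `f`, it shows that input in a single coordinate `i` must make some output coordinate
grow. Applied to `f.symm`, it shows that no output coordinate can grow from two different input
coordinates (`SyncLocal.eq_of_grows`). Growth therefore defines a permutation `ψ`. A loop argument
(`SyncLocal.output_apply_eq_one`) upgrades absence of growth to absence of any output at all core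
states.

Finally, `ψ` reverses products, so `ψ⁻¹` is a homomorphism onto the symmetric group. It is split by
the coordinate permutations `permHomeo`, its kernel is `d𝒦_{n,1}`, and conjugation by `permHomeo`
renames coordinates. This is the semidirect product. -/

namespace BrinThompson

open Topology DNTransducer

/-! ### Infinite words -/

section Streams

variable {n : ℕ}

/-- The infinite word `u x`. -/
def consWord (u : FreeMonoid (Fin n)) (x : ℕ → Fin n) : ℕ → Fin n :=
  fun j => (u.toList[j]?).getD (x (j - u.length))

/-- The infinite word `x` without its first `m` letters. -/
def shift (m : ℕ) (x : ℕ → Fin n) : ℕ → Fin n := fun j => x (j + m)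

/-- The prefix of length `m` of an infinite word. -/
def initWord (x : ℕ → Fin n) (m : ℕ) : FreeMonoid (Fin n) :=
  FreeMonoid.ofList ((List.range m).map x)

@[simp] theorem length_initWord (x : ℕ → Fin n) (m : ℕ) : (initWord x m).length = m := by
  simp [initWord, FreeMonoid.length]

theorem consWord_of_lt (u : FreeMonoid (Fin n)) (x : ℕ → Fin n) {j : ℕ}
    (hj : j < u.toList.length) : consWord u x j = u.toList[j] := by
  simp [consWord, hj]

theorem consWord_add (u : FreeMonoid (Fin n)) (x : ℕ → Fin n) (j : ℕ) :
    consWord u x (j + u.length) = x j := by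
  have h : u.toList[j + u.length]? = none := by
    simp [FreeMonoid.length]
  simp [consWord, h]

theorem shift_consWord (u : FreeMonoid (Fin n)) (x : ℕ → Fin n) :
    shift u.length (consWord u x) = x :=
  funext fun j => consWord_add u x j

theorem consWord_mul (u v : FreeMonoid (Fin n)) (x : ℕ → Fin n) :
    consWord (u * v) x = consWord u (consWord v x) := by
  funext j
  simp only [consWord, FreeMonoid.toList_mul, List.getElem?_append, FreeMonoid.length_mul]
  split_ifs with h
  · simp [h]
  · have h2 : u.toList[j]? = none := by simpa using h
    rw [h2]
    simp [FreeMonoid.length, Nat.sub_sub]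

theorem consWord_injective (u : FreeMonoid (Fin n)) : Function.Injective (consWord u) := by
  intro x y h
  rw [← shift_consWord u x, h, shift_consWord]

theorem isPrefixOf_consWord (u : FreeMonoid (Fin n)) (x : ℕ → Fin n) :
    IsPrefixOf u (consWord u x) := fun _ hj => (consWord_of_lt u x hj).symm

theorem IsPrefixOf.consWord_shift {u : FreeMonoid (Fin n)} {x : ℕ → Fin n}
    (h : IsPrefixOf u x) : consWord u (shift u.length x) = x := by
  funext j
  by_cases hj : j < u.toList.length
  · rw [consWord_of_lt _ _ hj, h j hj]
  · obtain ⟨m, rfl⟩ := Nat.exists_eq_add_of_le' (not_lt.mp hj)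
    exact consWord_add u _ m

theorem isPrefixOf_initWord (x : ℕ → Fin n) (m : ℕ) : IsPrefixOf (initWord x m) x := by
  intro j hj
  simp [initWord]

/-- Divisibility in the free monoid is left divisibility, so `∣` serves as the prefix order on
finite words, and coordinatewise on tuples. -/
theorem IsPrefixOf.dvd {u v : FreeMonoid (Fin n)} {x : ℕ → Fin n} (hu : IsPrefixOf u x)
    (hv : IsPrefixOf v x) (h : u.length ≤ v.length) : u ∣ v := by
  have hp : u.toList <+: v.toList := by
    rw [List.prefix_iff_getElem]
    exact ⟨h, fun j hj => (hu j hj).trans (hv j (lt_of_lt_of_le hj h)).symm⟩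
  obtain ⟨w, hw⟩ := hp
  exact ⟨FreeMonoid.ofList w, FreeMonoid.toList.injective hw.symm⟩

theorem prefix_of_dvd {u v : FreeMonoid (Fin n)} (h : u ∣ v) : u.toList <+: v.toList := by
  obtain ⟨w, rfl⟩ := h
  exact ⟨w.toList, rfl⟩

theorem dvd_of_prefix {u v : FreeMonoid (Fin n)} (h : u.toList <+: v.toList) : u ∣ v := by
  obtain ⟨w, hw⟩ := h
  exact ⟨FreeMonoid.ofList w, FreeMonoid.toList.injective hw.symm⟩

theorem length_le_of_dvd {u v : FreeMonoid (Fin n)} (h : u ∣ v) : u.length ≤ v.length := by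
  obtain ⟨w, rfl⟩ := h
  simp

theorem eq_of_dvd_of_length_le {u v : FreeMonoid (Fin n)} (h : u ∣ v)
    (hl : v.length ≤ u.length) : u = v := by
  obtain ⟨w, rfl⟩ := h
  have : w.length = 0 := by
    rw [FreeMonoid.length_mul] at hl
    omega
  rw [FreeMonoid.length_eq_zero.mp this, mul_one]

theorem isPrefixOf_mul_consWord {u v : FreeMonoid (Fin n)} {x : ℕ → Fin n} :
    IsPrefixOf (u * v) (consWord u x) ↔ IsPrefixOf v x := by
  constructor
  · intro h
    have h2 := h.consWord_shift
    rw [consWord_mul] at h2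
    rw [← consWord_injective u h2]
    exact isPrefixOf_consWord _ _
  · intro h
    rw [← h.consWord_shift, ← consWord_mul]
    exact isPrefixOf_consWord _ _

theorem IsPrefixOf.of_dvd {u v : FreeMonoid (Fin n)} {x : ℕ → Fin n} (hv : IsPrefixOf v x)
    (h : u ∣ v) : IsPrefixOf u x := by
  obtain ⟨w, rfl⟩ := h
  rw [← hv.consWord_shift, consWord_mul]
  exact isPrefixOf_consWord _ _

theorem IsLCP.eq {u v : FreeMonoid (Fin n)} {S : Set (ℕ → Fin n)} (hu : IsLCP u S)
    (hv : IsLCP v S) : u = v :=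
  eq_of_dvd_of_length_le (dvd_of_prefix (hv.2 u hu.1))
    (length_le_of_dvd (dvd_of_prefix (hu.2 v hv.1)))

theorem lcp_image_consWord {S : Set (ℕ → Fin n)} (hS : S.Nontrivial) (u : FreeMonoid (Fin n)) :
    lcp (consWord u '' S) = u * lcp S := by
  refine (isLCP_lcp (hS.image (consWord_injective u))).eq ⟨?_, fun v hv => ?_⟩
  · rintro _ ⟨x, hx, rfl⟩
    exact isPrefixOf_mul_consWord.mpr ((isLCP_lcp hS).1 x hx)
  · apply prefix_of_dvd
    obtain ⟨x, hx⟩ := hS.nonempty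
    have hvx := hv _ ⟨x, hx, rfl⟩
    rcases le_total v.length u.length with hl | hl
    · exact (hvx.dvd (isPrefixOf_consWord u x) hl).mul_right _
    · obtain ⟨w, rfl⟩ := (isPrefixOf_consWord u x).dvd hvx hl
      refine mul_dvd_mul_left u (dvd_of_prefix ((isLCP_lcp hS).2 w fun y hy => ?_))
      exact isPrefixOf_mul_consWord.mp (hv _ ⟨y, hy, rfl⟩)

/-- Cancelling the shorter word leaves `x = w x` for all `x`. A nonempty `w` would force all
infinite words to begin with the same letter, which fails for two constant words. -/
theorem eq_of_consWord_eq [n.AtLeastTwo] {u v : FreeMonoid (Fin n)}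
    (h : ∀ x, consWord u x = consWord v x) : u = v := by
  wlog hl : u.length ≤ v.length generalizing u v
  · exact (this (fun x => (h x).symm) (not_le.mp hl).le).symm
  have : Nontrivial (Fin n) := Fin.nontrivial_iff_two_le.mpr Nat.AtLeastTwo.prop
  obtain ⟨a, b, hab⟩ := exists_pair_ne (Fin n)
  obtain ⟨w, rfl⟩ := ((h fun _ => a) ▸ isPrefixOf_consWord u _ : IsPrefixOf u _).dvd
    (isPrefixOf_consWord v fun _ => a) hl
  have hw : ∀ x, x = consWord w x := fun x => consWord_injective u (by rw [h, consWord_mul])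
  rcases eq_or_ne w 1 with rfl | hne
  · simp
  · have hpos : 0 < w.toList.length := by
      rw [Nat.pos_iff_ne_zero]
      exact fun h0 => hne (FreeMonoid.length_eq_zero.mp h0)
    have ha := congrFun (hw fun _ => a) 0
    have hb := congrFun (hw fun _ => b) 0
    rw [consWord_of_lt _ _ hpos] at ha hb
    exact absurd (ha.trans hb.symm) hab

end Streams

/-! ### Tuples of infinite words -/

section Local

variable {d n : ℕ}

/-- The point `w x` of the Cantor space. -/
def consPt (w : Words d n) (x : Cantor d n) : Cantor d n := fun i => consWord (w i) (x i)

theorem consPt_mul (u v : Words d n) (x : Cantor d n) :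
    consPt (u * v) x = consPt u (consPt v x) :=
  funext fun _ => consWord_mul _ _ _

theorem consPt_injective (u : Words d n) : Function.Injective (consPt u) := fun _ _ h =>
  funext fun i => consWord_injective (u i) (congrFun h i)

theorem range_consPt (w : Words d n) : Set.range (consPt w) = cone w := by
  ext x
  constructor
  · rintro ⟨y, rfl⟩ i
    exact isPrefixOf_consWord _ _
  · intro h
    exact ⟨fun i => shift (w i).length (x i), funext fun i => (h i).consWord_shift⟩

theorem eq_of_consPt_eq [n.AtLeastTwo] {u v : Words d n} (h : ∀ x, consPt u x = consPt v x) :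
    u = v :=
  funext fun i => eq_of_consWord_eq fun x => congrFun (h fun _ => x) i

/-- All coordinates of `φ` have at least two values. -/
def CoordNontrivial (φ : Cantor d n → Cantor d n) : Prop :=
  ∀ i, (Set.range fun x => φ x i).Nontrivial

/-- The longest common prefixes of the coordinates of the values of `φ`. -/
noncomputable def commonPrefix (φ : Cantor d n → Cantor d n) : Words d n :=
  fun i => lcp (Set.range fun x => φ x i)

/-- The map `φ` with the longest common prefix of its values removed. -/
noncomputable def reduced (φ : Cantor d n → Cantor d n) : Cantor d n → Cantor d n :=
  fun x i => shift (commonPrefix φ i).length (φ x i)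

theorem range_consPt_comp (u : Words d n) (φ : Cantor d n → Cantor d n) (i : Fin d) :
    (Set.range fun x => (consPt u ∘ φ) x i) = consWord (u i) '' Set.range fun x => φ x i := by
  rw [← Set.range_comp]
  rfl

theorem coordNontrivial_consPt_comp {u : Words d n} {φ : Cantor d n → Cantor d n} :
    CoordNontrivial (consPt u ∘ φ) ↔ CoordNontrivial φ := by
  refine forall_congr' fun i => ?_
  rw [range_consPt_comp]
  refine ⟨fun h => ?_, fun h => h.image (consWord_injective _)⟩
  exact Set.nontrivial_of_image _ _ h

theorem CoordNontrivial.commonPrefix_consPt_comp {φ : Cantor d n → Cantor d n}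
    (h : CoordNontrivial φ) (u : Words d n) :
    commonPrefix (consPt u ∘ φ) = u * commonPrefix φ := by
  funext i
  rw [commonPrefix, range_consPt_comp, lcp_image_consWord (h i)]
  rfl

theorem CoordNontrivial.consPt_commonPrefix_reduced {φ : Cantor d n → Cantor d n}
    (h : CoordNontrivial φ) (x : Cantor d n) : consPt (commonPrefix φ) (reduced φ x) = φ x :=
  funext fun i => ((isLCP_lcp (h i)).1 _ ⟨x, rfl⟩ : IsPrefixOf _ _).consWord_shift

theorem CoordNontrivial.consPt_comp_reduced {φ : Cantor d n → Cantor d n}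
    (h : CoordNontrivial φ) : consPt (commonPrefix φ) ∘ reduced φ = φ :=
  funext h.consPt_commonPrefix_reduced

theorem CoordNontrivial.reduced_consPt_comp {φ : Cantor d n → Cantor d n}
    (h : CoordNontrivial φ) (u : Words d n) : reduced (consPt u ∘ φ) = reduced φ := by
  funext x
  apply consPt_injective (u * commonPrefix φ)
  rw [← h.commonPrefix_consPt_comp u,
    (coordNontrivial_consPt_comp.mpr h).consPt_commonPrefix_reduced,
    h.commonPrefix_consPt_comp u, consPt_mul, h.consPt_commonPrefix_reduced]
  rfl

theorem coordImage_eq_range (h : Cantor d n ≃ₜ Cantor d n) (s : Words d n) (i : Fin d) :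
    coordImage h s i = Set.range fun x => (h ∘ consPt s) x i := by
  rw [coordImage, ← range_consPt, ← Set.range_comp, ← Set.range_comp]
  rfl

/-- The longest common prefix of the image of the cone of `s`. -/
noncomputable def imagePrefix (h : Cantor d n ≃ₜ Cantor d n) (s : Words d n) : Words d n :=
  commonPrefix (h ∘ consPt s)

/-- The local map of `h` at the cone of `s`. -/
noncomputable def localMap (h : Cantor d n ≃ₜ Cantor d n) (s : Words d n) :
    Cantor d n → Cantor d n :=
  reduced (h ∘ consPt s)

/-- The output function of the state `s`. -/
noncomputable def output (h : Cantor d n ≃ₜ Cantor d n) (s t : Words d n) : Words d n :=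
  commonPrefix (localMap h s ∘ consPt t)

theorem output_congr {h g : Cantor d n ≃ₜ Cantor d n} {s s' : Words d n}
    (e : localMap h s = localMap g s') : output h s = output g s' := by
  funext t
  rw [output, output, e]

variable [n.AtLeastTwo]

theorem coordNontrivial_comp_consPt (h : Cantor d n ≃ₜ Cantor d n) (s : Words d n) :
    CoordNontrivial (h ∘ consPt s) := fun i => by
  rw [← coordImage_eq_range]
  exact coordImage_nontrivial h s i

theorem consPt_comp_localMap (h : Cantor d n ≃ₜ Cantor d n) (s : Words d n) :
    consPt (imagePrefix h s) ∘ localMap h s = h ∘ consPt s :=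
  (coordNontrivial_comp_consPt h s).consPt_comp_reduced

theorem consPt_localMap (h : Cantor d n ≃ₜ Cantor d n) (s : Words d n) (x : Cantor d n) :
    consPt (imagePrefix h s) (localMap h s x) = h (consPt s x) :=
  congrFun (consPt_comp_localMap h s) x

theorem comp_consPt_mul (h : Cantor d n ≃ₜ Cantor d n) (s t : Words d n) :
    h ∘ consPt (s * t) = consPt (imagePrefix h s) ∘ (localMap h s ∘ consPt t) := by
  rw [← Function.comp_assoc, consPt_comp_localMap]
  exact funext fun x => congrArg h (consPt_mul s t x)

theorem coordNontrivial_localMap_comp (h : Cantor d n ≃ₜ Cantor d n) (s t : Words d n) :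
    CoordNontrivial (localMap h s ∘ consPt t) := by
  rw [← coordNontrivial_consPt_comp (u := imagePrefix h s), ← comp_consPt_mul]
  exact coordNontrivial_comp_consPt h _

theorem imagePrefix_mul (h : Cantor d n ≃ₜ Cantor d n) (s t : Words d n) :
    imagePrefix h (s * t) = imagePrefix h s * output h s t := by
  rw [imagePrefix, comp_consPt_mul,
    (coordNontrivial_localMap_comp h s t).commonPrefix_consPt_comp]
  rfl

/-- The right side involves `s` only through `localMap h s`: a local map carries all the information
of a state. -/
theorem localMap_mul (h : Cantor d n ≃ₜ Cantor d n) (s t : Words d n) :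
    localMap h (s * t) = reduced (localMap h s ∘ consPt t) := by
  rw [localMap, comp_consPt_mul, (coordNontrivial_localMap_comp h s t).reduced_consPt_comp]

theorem localMap_consPt (h : Cantor d n ≃ₜ Cantor d n) (s t : Words d n) (x : Cantor d n) :
    localMap h s (consPt t x) = consPt (output h s t) (localMap h (s * t) x) := by
  rw [localMap_mul, output, (coordNontrivial_localMap_comp h s t).consPt_commonPrefix_reduced]
  rfl

theorem output_mul (h : Cantor d n ≃ₜ Cantor d n) (s t u : Words d n) :
    output h s (t * u) = output h s t * output h (s * t) u := by
  have h1 := imagePrefix_mul h s (t * u)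
  rw [← mul_assoc, imagePrefix_mul, imagePrefix_mul, mul_assoc] at h1
  exact (mul_left_cancel h1).symm

theorem localMap_mul_congr {h g : Cantor d n ≃ₜ Cantor d n} {s s' : Words d n}
    (e : localMap h s = localMap g s') (t : Words d n) :
    localMap h (s * t) = localMap g (s' * t) := by
  rw [localMap_mul, localMap_mul, e]

theorem trans_comp_consPt (f g : Cantor d n ≃ₜ Cantor d n) (s : Words d n) :
    f.trans g ∘ consPt s =
      consPt (imagePrefix g (imagePrefix f s)) ∘
        (localMap g (imagePrefix f s) ∘ localMap f s) := by
  rw [← Function.comp_assoc, consPt_comp_localMap, Function.comp_assoc, consPt_comp_localMap]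
  rfl

theorem coordNontrivial_localMap_comp_localMap (f g : Cantor d n ≃ₜ Cantor d n)
    (s : Words d n) : CoordNontrivial (localMap g (imagePrefix f s) ∘ localMap f s) := by
  rw [← coordNontrivial_consPt_comp (u := imagePrefix g (imagePrefix f s)),
    ← trans_comp_consPt]
  exact coordNontrivial_comp_consPt _ _

theorem localMap_trans (f g : Cantor d n ≃ₜ Cantor d n) (s : Words d n) :
    localMap (f.trans g) s = reduced (localMap g (imagePrefix f s) ∘ localMap f s) := by
  rw [localMap, trans_comp_consPt,
    (coordNontrivial_localMap_comp_localMap f g s).reduced_consPt_comp]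

/-- In general only divisibility holds: the composite of two reduced local maps may again have a
common prefix. -/
theorem imagePrefix_dvd_trans (f g : Cantor d n ≃ₜ Cantor d n) (s : Words d n) :
    imagePrefix g (imagePrefix f s) ∣ imagePrefix (f.trans g) s := by
  rw [imagePrefix.eq_1 (f.trans g), trans_comp_consPt,
    (coordNontrivial_localMap_comp_localMap f g s).commonPrefix_consPt_comp]
  exact dvd_mul_right _ _

theorem homeoTransducer_out (h : Cantor d n ≃ₜ Cantor d n) :
    (homeoTransducer h).out = output h := by
  refine funext fun (s : Words d n) => funext fun t => funext fun i => ?_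
  have e : ∀ s : Words d n, lcp (coordImage h s i) = imagePrefix h s i := fun s => by
    rw [coordImage_eq_range]
    rfl
  change wordSub (lcp (coordImage h (s * t) i)) (lcp (coordImage h s i)) = output h s t i
  rw [e, e, imagePrefix_mul]
  apply FreeMonoid.toList.injective
  simp [wordSub]

end Local

/-! ### Synchronization in terms of local maps; finiteness and closure under composition. -/

section Sync

variable {d n : ℕ}

/-- All coordinates of `w` have length at least `k`. -/
def Deep (k : ℕ) (w : Words d n) : Prop := ∀ i, k ≤ (w i).length

theorem Deep.mono {k m : ℕ} {w : Words d n} (h : Deep m w) (hkm : k ≤ m) : Deep k w :=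
  fun i => hkm.trans (h i)

theorem Deep.mul_left {k : ℕ} {w : Words d n} (h : Deep k w) (p : Words d n) :
    Deep k (p * w) := fun i => by
  rw [Pi.mul_apply, FreeMonoid.length_mul]
  exact (h i).trans (Nat.le_add_left _ _)

theorem Deep.mul_right {k : ℕ} {w : Words d n} (h : Deep k w) (p : Words d n) :
    Deep k (w * p) := fun i => by
  rw [Pi.mul_apply, FreeMonoid.length_mul]
  exact (h i).trans (Nat.le_add_right _ _)

theorem exists_take_mul_drop (w : FreeMonoid (Fin n)) {k : ℕ} (hk : k ≤ w.length) :
    ∃ u v : FreeMonoid (Fin n), w = u * v ∧ u.length = k :=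
  ⟨FreeMonoid.ofList (w.toList.take k), FreeMonoid.ofList (w.toList.drop k),
    FreeMonoid.toList.injective (List.take_append_drop k w.toList).symm,
    by simpa [FreeMonoid.length] using hk⟩

theorem Deep.exists_prefix {k : ℕ} {w : Words d n} (h : Deep k w) :
    ∃ u v : Words d n, w = u * v ∧ ∀ i, (u i).length = k := by
  choose u v huv hu using fun i => exists_take_mul_drop (w i) (h i)
  exact ⟨u, v, funext huv, hu⟩

theorem Deep.exists_mul {k m : ℕ} {w : Words d n} (h : Deep (k + m) w) :
    ∃ u v : Words d n, w = u * v ∧ Deep k u ∧ Deep m v := by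
  obtain ⟨u, v, rfl, hu⟩ := (h.mono (Nat.le_add_right k m)).exists_prefix
  refine ⟨u, v, rfl, fun i => (hu i).ge, fun i => ?_⟩
  have := h i
  rw [Pi.mul_apply, FreeMonoid.length_mul, hu i] at this
  omega

theorem Deep.exists_suffix {k : ℕ} {w : Words d n} (h : Deep k w) :
    ∃ u v : Words d n, w = u * v ∧ ∀ i, (v i).length = k := by
  choose u v huv hu using fun i => exists_take_mul_drop (w i) (Nat.sub_le (w i).length k)
  refine ⟨u, v, funext huv, fun i => ?_⟩
  have h1 := congrArg FreeMonoid.length (huv i)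
  rw [FreeMonoid.length_mul, hu i] at h1
  have := h i
  omega

theorem exists_deep [n.AtLeastTwo] (d k : ℕ) : ∃ w : Words d n, Deep k w := by
  have hn : 0 < n := lt_of_lt_of_le two_pos (Nat.AtLeastTwo.prop (n := n))
  exact ⟨fun _ => FreeMonoid.ofList (List.replicate k ⟨0, hn⟩), fun i => by
    simp [FreeMonoid.length]⟩

theorem finite_words_length_le (B : Fin d → ℕ) :
    {w : Words d n | ∀ i, (w i).length ≤ B i}.Finite := by
  have h := Set.Finite.pi fun i => List.finite_length_le (Fin n) (B i)
  refine h.subset fun w hw => ?_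
  rw [Set.mem_univ_pi]
  exact hw

theorem exists_forall_length_le {S : Set (Words d n)} (hS : S.Finite) :
    ∃ B, ∀ w ∈ S, ∀ i, (w i).length ≤ B := by
  obtain ⟨B, hB⟩ := (hS.image fun w => ∑ i, (w i).length).bddAbove
  exact ⟨B, fun w hw i => (Finset.single_le_sum (f := fun i => (w i).length)
    (fun _ _ => Nat.zero_le _) (Finset.mem_univ i)).trans (hB ⟨w, hw, rfl⟩)⟩

/-- The prefix of a point of length `m` in all coordinates. -/
def initPt (x : Cantor d n) (m : ℕ) : Words d n := fun i => initWord (x i) m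

theorem isClosed_cone (w : Words d n) : IsClosed (cone w) := by
  have : cone w = ⋂ i : Fin d, ⋂ j : Fin (w i).toList.length,
      {x : Cantor d n | (w i).toList[j] = x i j} := by
    ext x
    simp only [cone, IsPrefixOf, Set.mem_ofPred_eq, Set.mem_iInter]
    exact ⟨fun h i j => h i j j.2, fun h i j hj => h i ⟨j, hj⟩⟩
  rw [this]
  refine isClosed_iInter fun i => isClosed_iInter fun j => ?_
  have hc : Continuous fun x : Cantor d n => x i j := by fun_prop
  exact (isClosed_discrete {a : Fin n | (w i).toList[j] = a}).preimage hc

theorem isPrefixOf_initWord_iff {x y : ℕ → Fin n} {m : ℕ} :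
    IsPrefixOf (initWord x m) y ↔ ∀ j < m, x j = y j := by
  constructor
  · intro h j hj
    simpa [initWord] using h j (by simpa [initWord] using hj)
  · intro h j hj
    have hj' : j < m := by simpa [initWord] using hj
    simpa [initWord] using h j hj'

/-- The cones of the prefixes of `x` are closed, decreasing and intersect in `x` alone, so
compactness puts one of them inside `U`. -/
theorem exists_cone_subset (x : Cantor d n) {U : Set (Cantor d n)} (hU : U ∈ 𝓝 x) :
    ∃ m, cone (initPt x m) ⊆ U := by
  refine exists_subset_nhds_of_compactSpace (V := fun m => cone (initPt x m)) ?_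
    (fun m => isClosed_cone _) fun y hy => ?_
  · refine Antitone.directed_ge fun m k hmk y hy i => ?_
    exact isPrefixOf_initWord_iff.mpr fun j hj =>
      isPrefixOf_initWord_iff.mp (hy i) j (hj.trans_le hmk)
  · have : x = y := by
      funext i j
      exact isPrefixOf_initWord_iff.mp (Set.mem_iInter.mp hy (j + 1) i) j j.lt_succ_self
    exact this ▸ hU

theorem exists_consPt_initPt (x : Cantor d n) (m : ℕ) :
    ∃ y, x = consPt (initPt x m) y := by
  have h : x ∈ cone (initPt x m) := fun i => isPrefixOf_initWord _ _
  rw [← range_consPt] at h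
  obtain ⟨y, hy⟩ := h
  exact ⟨y, hy.symm⟩

theorem deep_initPt (x : Cantor d n) (m : ℕ) : Deep m (initPt x m) := fun i => by
  simp [initPt]

/-- Reading words of length at least `k` from any two states leads to the same local map. -/
def SyncLocal (h : Cantor d n ≃ₜ Cantor d n) (k : ℕ) : Prop :=
  ∀ p q w : Words d n, Deep k w → localMap h (p * w) = localMap h (q * w)

theorem SyncLocal.mono {h : Cantor d n ≃ₜ Cantor d n} {k m : ℕ} (hk : SyncLocal h k)
    (hkm : k ≤ m) : SyncLocal h m :=
  fun p q w hw => hk p q w (hw.mono hkm)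

theorem SyncLocal.localMap_mul {h : Cantor d n ≃ₜ Cantor d n} {k : ℕ} (hk : SyncLocal h k)
    (p : Words d n) {w : Words d n} (hw : Deep k w) : localMap h (p * w) = localMap h w := by
  rw [hk p 1 w hw, one_mul]

/-- There are only finitely many local maps at deep words. -/
theorem SyncLocal.finite_localMap {h : Cantor d n ≃ₜ Cantor d n} {k : ℕ}
    (hk : SyncLocal h k) : (localMap h '' {s | Deep k s}).Finite := by
  refine ((finite_words_length_le fun _ => k).image (localMap h)).subset ?_
  rintro _ ⟨s, hs, rfl⟩
  -- The suffix `v` of length exactly `k` already determines the local map, and there are finitely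
  -- many such suffixes.
  obtain ⟨u, v, rfl, hv⟩ := Deep.exists_suffix hs
  exact ⟨v, fun i => (hv i).le, (hk.localMap_mul u fun i => (hv i).ge).symm⟩

variable [n.AtLeastTwo]

theorem dvd_imagePrefix {h : Cantor d n ≃ₜ Cantor d n} {u : FreeMonoid (Fin n)}
    {w : Words d n} {i : Fin d} (hu : ∀ y, IsPrefixOf u (h (consPt w y) i)) :
    u ∣ imagePrefix h w i := by
  refine dvd_of_prefix ((isLCP_lcp (coordNontrivial_comp_consPt h w i)).2 u ?_)
  rintro _ ⟨y, rfl⟩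
  exact hu y

/-- The images of small cones have long common prefixes. -/
theorem exists_deep_imagePrefix (h : Cantor d n ≃ₜ Cantor d n) (K : ℕ) :
    ∃ M, ∀ w, Deep M w → Deep K (imagePrefix h w) := by
  have h1 : ∀ x, ∃ m, cone (initPt x m) ⊆ h ⁻¹' cone (initPt (h x) K) := fun x =>
    exists_cone_subset x (((isOpen_cone _).preimage h.continuous).mem_nhds
      fun i => isPrefixOf_initWord _ _)
  choose m hm using h1
  -- Finitely many cones mapped into cones of depth `K` cover the space; a word at least as long as
  -- all their prefixes has its cone inside one of them.
  obtain ⟨t, -, ht⟩ := isCompact_univ.elim_nhds_subcover (fun x => cone (initPt x (m x)))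
    fun x _ => (isOpen_cone _).mem_nhds fun i => isPrefixOf_initWord _ _
  refine ⟨t.sup m, fun w hw i => ?_⟩
  obtain ⟨z, hz⟩ := cone_nonempty w
  obtain ⟨x, hx, hzx⟩ := Set.mem_iUnion₂.mp (ht (Set.mem_univ z))
  have hsub : ∀ y, h (consPt w y) ∈ cone (initPt (h x) K) := fun y => hm x fun i =>
    (isPrefixOf_consWord (w i) (y i)).of_dvd ((hzx i).dvd (hz i)
      (by simpa [initPt] using (Finset.le_sup hx).trans (hw i)))
  simpa [initPt] using length_le_of_dvd (dvd_imagePrefix fun y => hsub y i)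

theorem exists_lt_length_output (h : Cantor d n ≃ₜ Cantor d n) (s : Words d n) (j : ℕ) :
    ∃ M, ∀ t, Deep M t → ∀ i, j < (output h s t i).length := by
  obtain ⟨B, hB⟩ := exists_forall_length_le (Set.finite_singleton (imagePrefix h s))
  obtain ⟨M, hM⟩ := exists_deep_imagePrefix h (B + j + 1)
  refine ⟨M, fun t ht i => ?_⟩
  have h1 := hM _ (ht.mul_left s) i
  rw [imagePrefix_mul, Pi.mul_apply, FreeMonoid.length_mul] at h1
  have := hB _ rfl i
  omega

/-- Each letter of the image of `x` is already written by the output on a long enough prefix of `x`.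
-/
theorem localMap_eq_of_output_eq {h g : Cantor d n ≃ₜ Cantor d n} {s s' : Words d n}
    (e : output h s = output g s') : localMap h s = localMap g s' := by
  funext x i j
  obtain ⟨M, hM⟩ := exists_lt_length_output h s j
  obtain ⟨y, hy⟩ := exists_consPt_initPt x M
  have hj := hM _ (deep_initPt x M) i
  rw [hy, localMap_consPt, localMap_consPt, ← e]
  exact (consWord_of_lt _ _ hj).trans (consWord_of_lt _ _ hj).symm

theorem mem_syncHomeos_iff {h : Cantor d n ≃ₜ Cantor d n} :
    h ∈ syncHomeos d n ↔ ∃ k, SyncLocal h k := by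
  refine exists_congr fun k => ⟨fun hs p q w hw => ?_, fun hs p q w hw => ?_⟩
  · apply localMap_eq_of_output_eq
    have h1 := hs (Quotient.mk _ p) (Quotient.mk _ q) w hw
    have h2 : ∀ t, (homeoTransducer h).out (p * w) t = (homeoTransducer h).out (q * w) t :=
      Quotient.exact h1
    rw [homeoTransducer_out] at h2
    exact funext h2
  · induction p using Quotient.inductionOn with
    | h p =>
      induction q using Quotient.inductionOn with
      | h q =>
        refine Quotient.sound fun t => ?_
        have h1 := congrFun (output_congr (hs p q w hw)) t
        rw [← homeoTransducer_out] at h1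
        exact h1

/-- Only finitely many deep words have images with short common prefixes. -/
theorem SyncLocal.finite_imagePrefix_le {h : Cantor d n ≃ₜ Cantor d n} {k : ℕ}
    (hk : SyncLocal h k) (B : Fin d → ℕ) :
    {t | Deep k t ∧ ∀ i, (imagePrefix h t i).length ≤ B i}.Finite := by
  -- The pair recovers `h ∘ consPt t`, hence `t` by injectivity of `h`, and it ranges over a finite
  -- set.
  refine Set.Finite.of_finite_image (f := fun t => (imagePrefix h t, localMap h t))
    (((finite_words_length_le B).prod hk.finite_localMap).subset ?_) ?_
  · rintro _ ⟨t, ⟨ht, hB⟩, rfl⟩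
    exact ⟨hB, t, ht, rfl⟩
  · intro s _ t _ hst
    obtain ⟨h1, h2⟩ := Prod.mk.injEq _ _ _ _ ▸ hst
    refine eq_of_consPt_eq fun x => h.injective ?_
    rw [← consPt_localMap, ← consPt_localMap, h1, h2]

/-- The bound is uniform in `s`: the output depends only on the suffix of `s` of length `k`, and the
image prefixes of these finitely many suffixes have lengths bounded by `B`. -/
theorem SyncLocal.exists_deep_output {h : Cantor d n ≃ₜ Cantor d n} {k : ℕ}
    (hk : SyncLocal h k) (K : ℕ) :
    ∃ M, ∀ s w, Deep k s → Deep M w → Deep K (output h s w) := by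
  obtain ⟨B, hB⟩ := exists_forall_length_le
    ((finite_words_length_le (n := n) fun _ : Fin d => k).image (imagePrefix h))
  obtain ⟨M, hM⟩ := exists_deep_imagePrefix h (B + K)
  refine ⟨M, fun s w hs hw i => ?_⟩
  obtain ⟨u, v, rfl, hv⟩ := hs.exists_suffix
  rw [output_congr (hk.localMap_mul u fun i => (hv i).ge)]
  have h1 := hM _ (hw.mul_left v) i
  rw [imagePrefix_mul, Pi.mul_apply, FreeMonoid.length_mul] at h1
  have := hB _ ⟨v, fun i => (hv i).le, rfl⟩ i
  omega

theorem SyncLocal.localMap_trans_mul {f g : Cantor d n ≃ₜ Cantor d n} {m : ℕ}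
    (hg : SyncLocal g m) {u v : Words d n} (hv : Deep m (output f u v)) :
    localMap (f.trans g) (u * v) =
      reduced (localMap g (output f u v) ∘ localMap f (u * v)) := by
  rw [localMap_trans, imagePrefix_mul, hg.localMap_mul _ hv]

/-- The first `k` letters synchronize `f`; the next `M` make `f` write at least `m` letters in every
coordinate, which synchronizes `g`. -/
theorem SyncLocal.exists_trans {f g : Cantor d n ≃ₜ Cantor d n} {k m : ℕ}
    (hf : SyncLocal f k) (hg : SyncLocal g m) : ∃ K, SyncLocal (f.trans g) K := by
  obtain ⟨M, hM⟩ := hf.exists_deep_output m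
  refine ⟨k + M, fun p q w hw => ?_⟩
  obtain ⟨u, v, rfl, hu, hv⟩ := hw.exists_mul
  have h1 : ∀ p, localMap (f.trans g) (p * (u * v)) =
      reduced (localMap g (output f u v) ∘ localMap f (u * v)) := fun p => by
    have h2 := output_congr (hf.localMap_mul p hu)
    rw [← mul_assoc, hg.localMap_trans_mul (by rw [h2]; exact hM u v hu hv), h2, mul_assoc,
      hf.localMap_mul p (hu.mul_right v)]
  rw [h1, h1]

end Sync

/-! ### The class of the core as a set of output functions; products of classes. -/

section Core

variable {d n : ℕ}

namespace DNTransducer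

theorem out_trans_eq_of_out_eq {A B : DNTransducer d n} {p : A.State} {q : B.State}
    (h : A.out p = B.out q) (s : Words d n) :
    A.out (A.trans p s) = B.out (B.trans q s) := by
  funext t
  have h1 := congrFun h (s * t)
  rw [A.out_mul, B.out_mul, h] at h1
  exact mul_left_cancel h1

/-- Transducers with pairwise inequivalent states are determined up to strong isomorphism by the
set of the output functions of their states. -/
theorem nonempty_strongIso_iff {A B : DNTransducer d n} (hB : Function.Injective B.out) :
    Nonempty (StrongIso A B) ↔ Function.Injective A.out ∧ Set.range A.out = Set.range B.out := by
  constructor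
  · rintro ⟨e⟩
    have h : A.out = B.out ∘ e.toEquiv := funext fun q => funext fun s => e.map_out q s
    rw [h]
    exact ⟨hB.comp e.toEquiv.injective, e.toEquiv.surjective.range_comp _⟩
  · rintro ⟨hA, h⟩
    let e : A.State ≃ B.State := (Equiv.ofInjective A.out hA).trans
      ((Equiv.setCongr h).trans (Equiv.ofInjective B.out hB).symm)
    have he : ∀ q, B.out (e q) = A.out q := fun q => Equiv.apply_ofInjective_symm hB _
    refine ⟨⟨e, fun q s => hB ?_, fun q s => by rw [he]⟩⟩
    rw [he, out_trans_eq_of_out_eq (he q).symm]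

theorem minimal_out_injective (T : DNTransducer d n) : Function.Injective T.minimal.out := by
  intro p q h
  induction p using Quotient.inductionOn with
  | h p =>
    induction q using Quotient.inductionOn with
    | h q => exact Quotient.sound fun t => congrFun h t

theorem core_out_injective {T : DNTransducer d n} (h : Function.Injective T.out) :
    Function.Injective T.core.out := fun _ _ e => Subtype.ext (h e)

end DNTransducer

/-- The output functions of the states of the core. -/
def coreOut (h : Cantor d n ≃ₜ Cantor d n) : Set (Words d n → Words d n) :=
  {o | ∃ w, ∀ p, output h (p * w) = o}

/-- Core states are those reached by deep words. Since `m` is free, several homeomorphisms can be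
compared at a common level. -/
theorem SyncLocal.coreOut_eq [n.AtLeastTwo] {h : Cantor d n ≃ₜ Cantor d n} {k m : ℕ}
    (hk : SyncLocal h k) (hkm : k ≤ m) : coreOut h = output h '' {s | Deep m s} := by
  ext o
  constructor
  · rintro ⟨w, hw⟩
    obtain ⟨p, hp⟩ := exists_deep (n := n) d m
    exact ⟨p * w, hp.mul_right w, hw p⟩
  · rintro ⟨s, hs, rfl⟩
    exact ⟨s, fun p => output_congr (hk.localMap_mul p (hs.mono hkm))⟩

variable [n.AtLeastTwo]

/-- The state of `M_h` given by the word `s`. -/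
noncomputable def minState (h : Cantor d n ≃ₜ Cantor d n) (s : Words d n) :
    (minTransducer h).State :=
  Quotient.mk _ s

theorem minState_surjective (h : Cantor d n ≃ₜ Cantor d n) :
    Function.Surjective (minState h) := Quotient.mk_surjective

theorem trans_minState (h : Cantor d n ≃ₜ Cantor d n) (s w : Words d n) :
    (minTransducer h).trans (minState h s) w = minState h (s * w) := rfl

theorem out_minState (h : Cantor d n ≃ₜ Cantor d n) (s : Words d n) :
    (minTransducer h).out (minState h s) = output h s := by
  rw [← homeoTransducer_out]
  rfl

theorem range_core_out (h : Cantor d n ≃ₜ Cantor d n) :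
    Set.range (minTransducer h).core.out = coreOut h := by
  ext o
  constructor
  · rintro ⟨⟨q, w, hw⟩, rfl⟩
    refine ⟨w, fun p => ?_⟩
    rw [← out_minState, ← trans_minState, hw]
    rfl
  · rintro ⟨w, hw⟩
    refine ⟨⟨minState h (1 * w), w, fun p => ?_⟩, ?_⟩
    · obtain ⟨p, rfl⟩ := minState_surjective h p
      apply DNTransducer.minimal_out_injective
      change (minTransducer h).out (minState h (p * w)) = (minTransducer h).out _
      rw [out_minState, out_minState, hw, hw]
    · exact (out_minState h (1 * w)).trans (hw 1)

theorem mk_eq_coreClass_iff {T : DNTransducer d n} {h : Cantor d n ≃ₜ Cantor d n} :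
    Quotient.mk (DNTransducer.strongIsoSetoid d n) T = coreClass h ↔
      Function.Injective T.out ∧ Set.range T.out = coreOut h := by
  rw [← range_core_out]
  exact Quotient.eq.trans (DNTransducer.nonempty_strongIso_iff
    (DNTransducer.core_out_injective (T := minTransducer h)
      (DNTransducer.minimal_out_injective _)))

theorem coreClass_eq_iff {f g : Cantor d n ≃ₜ Cantor d n} :
    coreClass f = coreClass g ↔ coreOut f = coreOut g := by
  rw [← range_core_out f]
  refine mk_eq_coreClass_iff.trans (and_iff_right ?_)
  exact DNTransducer.core_out_injective (DNTransducer.minimal_out_injective _)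

/-- A deep state of the product is determined by the state of `f` after `u`, by `v`, and by the
state of `g` after the word that `f` writes on `v`. Both states also occur for `f'` and `g'`. -/
theorem SyncLocal.coreOut_trans_subset {f g f' g' : Cantor d n ≃ₜ Cantor d n} {k : ℕ}
    (hf : SyncLocal f k) (hg : SyncLocal g k) (hf' : SyncLocal f' k) (hg' : SyncLocal g' k)
    (hff' : coreOut f ⊆ coreOut f') (hgg' : coreOut g ⊆ coreOut g') :
    coreOut (f.trans g) ⊆ coreOut (f'.trans g') := by
  obtain ⟨M, hM⟩ := hf.exists_deep_output k
  obtain ⟨K, hK⟩ := hf.exists_trans hg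
  obtain ⟨K', hK'⟩ := hf'.exists_trans hg'
  -- Of this level, `k` goes to `u`, `M` makes the output on `v` deep, `K'` makes `u' * v` deep
  -- enough for the target, and `K` makes the level admissible for `f.trans g`.
  rw [hK.coreOut_eq (m := k + (M + (K + K'))) (by omega), hK'.coreOut_eq le_rfl]
  rw [hf.coreOut_eq le_rfl, hf'.coreOut_eq le_rfl] at hff'
  rw [hg.coreOut_eq le_rfl, hg'.coreOut_eq le_rfl] at hgg'
  rintro _ ⟨s, hs, rfl⟩
  obtain ⟨u, v, rfl, hu, hv⟩ := hs.exists_mul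
  obtain ⟨u', hu', hfu⟩ := hff' ⟨u, hu, rfl⟩
  have ho := hM u v hu (hv.mono (Nat.le_add_right _ _))
  obtain ⟨t', ht', hgt⟩ := hgg' ⟨_, ho, rfl⟩
  have hg2 : localMap g' (output f u v) = localMap g (output f u v) := by
    rw [← hg'.localMap_mul t' ho, ← hg.localMap_mul (output f u v) ho]
    exact localMap_mul_congr (localMap_eq_of_output_eq hgt) _
  refine ⟨u' * v, (hv.mono (by omega)).mul_left u', output_congr ?_⟩
  rw [hg'.localMap_trans_mul (by rw [hfu]; exact ho), hg.localMap_trans_mul ho, hfu, hg2,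
    localMap_mul_congr (localMap_eq_of_output_eq hfu)]

theorem exists_syncLocal {S : Set (Cantor d n ≃ₜ Cantor d n)} (hS : S ⊆ syncHomeos d n)
    (hfin : S.Finite) : ∃ k, ∀ f ∈ S, SyncLocal f k := by
  have h : ∀ f ∈ S, ∃ k, SyncLocal f k := fun f hf => mem_syncHomeos_iff.mp (hS hf)
  choose! k hk using h
  obtain ⟨m, hm⟩ := (hfin.image k).bddAbove
  exact ⟨m, fun f hf => (hk f hf).mono (hm ⟨f, hf, rfl⟩)⟩

theorem trans_mem_syncHomeos {f g : Cantor d n ≃ₜ Cantor d n} (hf : f ∈ syncHomeos d n)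
    (hg : g ∈ syncHomeos d n) : f.trans g ∈ syncHomeos d n := by
  obtain ⟨k, hk⟩ := mem_syncHomeos_iff.mp hf
  obtain ⟨m, hm⟩ := mem_syncHomeos_iff.mp hg
  exact mem_syncHomeos_iff.mpr (hk.exists_trans hm)

theorem coreClass_trans_congr {f g f' g' : Cantor d n ≃ₜ Cantor d n}
    (hf : f ∈ syncHomeos d n) (hg : g ∈ syncHomeos d n) (hf' : f' ∈ syncHomeos d n)
    (hg' : g' ∈ syncHomeos d n) (hff' : coreClass f = coreClass f')
    (hgg' : coreClass g = coreClass g') :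
    coreClass (f.trans g) = coreClass (f'.trans g') := by
  obtain ⟨k, hk⟩ := exists_syncLocal (S := {f, g, f', g'})
    (by rintro _ (rfl | rfl | rfl | rfl) <;> assumption) (Set.toFinite _)
  have hkf := hk f (by simp)
  have hkg := hk g (by simp)
  have hkf' := hk f' (by simp)
  have hkg' := hk g' (by simp)
  rw [coreClass_eq_iff] at *
  exact (hkf.coreOut_trans_subset hkg hkf' hkg' hff'.le hgg'.le).antisymm
    (hkf'.coreOut_trans_subset hkg' hkf hkg hff'.ge hgg'.ge)

theorem mem_unitHomeos_iff {f : Cantor d n ≃ₜ Cantor d n} :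
    f ∈ unitHomeos d n ↔ f ∈ syncHomeos d n ∧ f.symm ∈ syncHomeos d n := by
  refine and_congr_right fun _ => ⟨?_, fun h => ⟨_, h, f.self_trans_symm, f.symm_trans_self⟩⟩
  rintro ⟨g, hg, hfg, -⟩
  have : f.symm = g := by
    ext1 x
    rw [Homeomorph.symm_apply_eq]
    have h2 := DFunLike.congr_fun hfg (f.symm x)
    have h3 : g x = f.symm x := by simpa using h2
    rw [h3, f.apply_symm_apply]
  rwa [this]

theorem trans_mem_unitHomeos {f g : Cantor d n ≃ₜ Cantor d n} (hf : f ∈ unitHomeos d n)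
    (hg : g ∈ unitHomeos d n) : f.trans g ∈ unitHomeos d n := by
  have e : (f.trans g).symm = g.symm.trans f.symm := rfl
  rw [mem_unitHomeos_iff] at *
  rw [e]
  exact ⟨trans_mem_syncHomeos hf.1 hg.1, trans_mem_syncHomeos hg.2 hf.2⟩

theorem symm_mem_unitHomeos {f : Cantor d n ≃ₜ Cantor d n} (hf : f ∈ unitHomeos d n) :
    f.symm ∈ unitHomeos d n := by
  rw [mem_unitHomeos_iff] at *
  exact ⟨hf.2, hf.1⟩

end Core

/-! ### Growth of outputs and the coordinate map. -/

section CoordMap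

variable {d n : ℕ}

theorem mulSingle_mem_wordsOn (i : Fin d) (u : FreeMonoid (Fin n)) :
    (Pi.mulSingle i u : Words d n) ∈ wordsOn d n {i} := fun j hj => by
  simp [show j ≠ i from hj]

theorem mul_mem_wordsOn {S : Set (Fin d)} {l m : Words d n} (hl : l ∈ wordsOn d n S)
    (hm : m ∈ wordsOn d n S) : l * m ∈ wordsOn d n S := fun j hj => by
  rw [Pi.mul_apply, hl j hj, hm j hj, mul_one]

theorem pow_mem_wordsOn {S : Set (Fin d)} {l : Words d n} (hl : l ∈ wordsOn d n S) (N : ℕ) :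
    l ^ N ∈ wordsOn d n S := fun j hj => by
  rw [Pi.pow_apply, hl j hj, one_pow]

theorem commute_of_mem_wordsOn {i : Fin d} {l r : Words d n} (hl : l ∈ wordsOn d n {i})
    (hr : r i = 1) : Commute l r := by
  funext j
  rcases eq_or_ne j i with rfl | hj
  · simp [hr]
  · simp [hl j hj]

theorem mulSingle_mul_update (i : Fin d) (s : Words d n) :
    Pi.mulSingle i (s i) * Function.update s i 1 = s := by
  funext j
  rcases eq_or_ne j i with rfl | hj
  · simp
  · simp [hj]

theorem dvd_of_dvd_of_length_le {u v w : FreeMonoid (Fin n)} (hu : u ∣ w) (hv : v ∣ w)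
    (h : u.length ≤ v.length) : u ∣ v :=
  dvd_of_prefix (List.prefix_of_prefix_length_le (prefix_of_dvd hu) (prefix_of_dvd hv) h)

/-- Reading in coordinate `i` from the state `s` writes arbitrarily long words in
coordinate `c`. -/
def Grows (f : Cantor d n ≃ₜ Cantor d n) (s : Words d n) (i c : Fin d) : Prop :=
  ∀ B, ∃ l ∈ wordsOn d n {i}, B ≤ (output f s l c).length

/-- From every state of the core, reading in coordinate `i` only writes in coordinate `ψ i`. -/
def CoreCoordMap (f : Cantor d n ≃ₜ Cantor d n) (ψ : Fin d → Fin d) : Prop :=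
  ∀ i, ∀ o ∈ coreOut f, ∀ l ∈ wordsOn d n {i}, o l ∈ wordsOn d n {ψ i}

theorem permHomeo_comp_consPt (σ : Equiv.Perm (Fin d)) (s : Words d n) :
    permHomeo n σ ∘ consPt s = consPt (s ∘ σ) ∘ permHomeo n σ := rfl

theorem permHomeo_one : permHomeo n (1 : Equiv.Perm (Fin d)) = Homeomorph.refl _ := rfl

variable [n.AtLeastTwo]

theorem lcp_univ : lcp (Set.univ : Set (ℕ → Fin n)) = 1 := by
  have : Nontrivial (Fin n) := Fin.nontrivial_iff_two_le.mpr Nat.AtLeastTwo.prop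
  obtain ⟨a, b, hab⟩ := exists_pair_ne (Fin n)
  have h := isLCP_lcp (Set.nontrivial_univ (α := ℕ → Fin n))
  rw [← FreeMonoid.length_eq_zero]
  by_contra h0
  have hpos := Nat.pos_of_ne_zero h0
  exact hab ((h.1 (fun _ => a) (Set.mem_univ _) 0 hpos).symm.trans
    (h.1 (fun _ => b) (Set.mem_univ _) 0 hpos))

theorem commonPrefix_permHomeo (σ : Equiv.Perm (Fin d)) :
    commonPrefix (permHomeo n σ) = 1 := by
  funext i
  have h : (Set.range fun x : Cantor d n => permHomeo n σ x i) = Set.univ :=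
    Set.range_eq_univ.mpr fun x => ⟨fun _ => x, rfl⟩
  rw [commonPrefix, h, lcp_univ]
  rfl

theorem coordNontrivial_permHomeo (σ : Equiv.Perm (Fin d)) :
    CoordNontrivial (permHomeo n σ) := by
  have h := coordNontrivial_comp_consPt (permHomeo n σ) 1
  rwa [permHomeo_comp_consPt, coordNontrivial_consPt_comp] at h

theorem imagePrefix_permHomeo (σ : Equiv.Perm (Fin d)) (s : Words d n) :
    imagePrefix (permHomeo n σ) s = s ∘ σ := by
  rw [imagePrefix, permHomeo_comp_consPt,
    (coordNontrivial_permHomeo σ).commonPrefix_consPt_comp, commonPrefix_permHomeo, mul_one]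

theorem localMap_permHomeo (σ : Equiv.Perm (Fin d)) (s : Words d n) :
    localMap (permHomeo n σ) s = permHomeo n σ := by
  funext x
  apply consPt_injective (s ∘ σ)
  rw [← imagePrefix_permHomeo, consPt_localMap, imagePrefix_permHomeo]
  rfl

/-- What `f.symm` writes on the output of `f` cannot go beyond the input `w`, since the composite is
the identity, whose image prefix is `w`. -/
theorem imagePrefix_symm_dvd (f : Cantor d n ≃ₜ Cantor d n) (w : Words d n) :
    imagePrefix f.symm (imagePrefix f w) ∣ w := by
  have h := imagePrefix_dvd_trans f f.symm w
  rwa [f.self_trans_symm, ← permHomeo_one, imagePrefix_permHomeo] at h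

/-- Inputs `l` in coordinate `i` and `l'` in `i' ≠ i` commute, so their outputs in coordinate `c`
are prefixes of one word and share a long prefix `u`. On `u`, the inverse can write no more than `s
* l` and no more than `s * l'`, hence no more than `s` in any coordinate. Finiteness for `f.symm`
bounds the length of such `u`. -/
theorem SyncLocal.eq_of_grows {f : Cantor d n ≃ₜ Cantor d n} {k : ℕ}
    (hk : SyncLocal f.symm k) {s : Words d n} (hs : Deep k (imagePrefix f s)) {i i' c : Fin d}
    (h : Grows f s i c) (h' : Grows f s i' c) : i = i' := by
  by_contra hne
  obtain ⟨B, hB⟩ := exists_forall_length_le (hk.finite_imagePrefix_le fun i => (s i).length)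
  obtain ⟨l, hl, hlB⟩ := h (B + 1)
  obtain ⟨l', hl', hlB'⟩ := h' (B + 1)
  obtain ⟨u, v, huv, hu⟩ := exists_take_mul_drop _ hlB
  have hdvd : u ∣ output f s l c := ⟨v, huv⟩
  have hdvd' : u ∣ output f s l' c := by
    refine dvd_of_dvd_of_length_le (w := output f s (l * l') c) ?_ ?_ (hu ▸ hlB')
    · rw [output_mul, Pi.mul_apply]
      exact hdvd.mul_right _
    · rw [(commute_of_mem_wordsOn hl (hl' i hne)).eq, output_mul, Pi.mul_apply]
      exact dvd_mul_right _ _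
  have key : ∀ l, u ∣ output f s l c → ∀ j,
      (imagePrefix f.symm (imagePrefix f s * Pi.mulSingle c u) j).length ≤
        ((s * l) j).length := by
    intro l hlu j
    have h1 : (Pi.mulSingle c u : Words d n) ∣ output f s l := by
      refine pi_dvd_iff.mpr fun j => ?_
      rcases eq_or_ne j c with rfl | hj
      · simpa using hlu
      · simp [hj]
    obtain ⟨r, hr⟩ := h1
    refine length_le_of_dvd (pi_dvd_iff.mp (dvd_trans ?_ (imagePrefix_symm_dvd f (s * l))) j)
    rw [imagePrefix_mul f s l, hr, ← mul_assoc, imagePrefix_mul f.symm _ r]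
    exact dvd_mul_right _ _
  have h1 := hB (imagePrefix f s * Pi.mulSingle c u) ⟨hs.mul_right _, fun j => ?_⟩ c
  · rw [Pi.mul_apply, FreeMonoid.length_mul, Pi.mulSingle_eq_same, hu] at h1
    omega
  · rcases eq_or_ne j i with rfl | hj
    · simpa [hl' j hne] using key l' hdvd' j
    · simpa [hl j hj] using key l hdvd j

/-- Extending `s` in coordinate `i` alone gives arbitrarily long deep words, and only finitely many
of them have image prefixes bounded by `B`. -/
theorem SyncLocal.exists_lt_length_imagePrefix {f : Cantor d n ≃ₜ Cantor d n} {k : ℕ}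
    (hk : SyncLocal f k) {s : Words d n} (hs : Deep k s) (i : Fin d) (B : Fin d → ℕ) :
    ∃ l ∈ wordsOn d n {i}, ∃ c, B c < (imagePrefix f (s * l) c).length := by
  obtain ⟨C, hC⟩ := exists_forall_length_le (hk.finite_imagePrefix_le B)
  obtain ⟨w, hw⟩ := exists_deep (n := n) d (C + 1)
  refine ⟨Pi.mulSingle i (w i), mulSingle_mem_wordsOn _ _, ?_⟩
  by_contra! hcon
  have h1 := hC _ ⟨hs.mul_right _, hcon⟩ i
  rw [Pi.mul_apply, FreeMonoid.length_mul, Pi.mulSingle_eq_same] at h1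
  have := hw i
  omega

theorem SyncLocal.exists_grows {f : Cantor d n ≃ₜ Cantor d n} {k : ℕ}
    (hk : SyncLocal f k) {s : Words d n} (hs : Deep k s) (i : Fin d) : ∃ c, Grows f s i c := by
  by_contra! hcon
  simp only [Grows, not_forall, not_exists, not_and, not_le] at hcon
  choose B hB using hcon
  obtain ⟨l, hl, c, hc⟩ := hk.exists_lt_length_imagePrefix hs i
    fun c => (imagePrefix f s c).length + B c
  rw [imagePrefix_mul, Pi.mul_apply, FreeMonoid.length_mul] at hc
  have := hB c l hl
  omega

/-- Going round a loop at a deep state repeats the output. -/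
theorem SyncLocal.output_pow {f : Cantor d n ≃ₜ Cantor d n} {k : ℕ}
    (hk : SyncLocal f k) {s : Words d n} (hs : Deep k s) {m q : Words d n}
    (h : s * m = q * s) (N : ℕ) : output f s (m ^ N) = output f s m ^ N := by
  have h1 : ∀ N, s * m ^ N = q ^ N * s := fun N =>
    (show SemiconjBy s m q from h).pow_right N
  induction N with
  | zero =>
    have h2 := output_mul f s 1 1
    simp only [mul_one] at h2
    simpa using h2
  | succ N ih => rw [pow_succ, output_mul, ih, h1, output_congr (hk.localMap_mul _ hs), pow_succ]

/-- A nonempty output at one deep state `t` could be repeated by going round a loop at `t`, and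
would then be unbounded. Reading the same letters from `s` with those of coordinate `i` first shows
that it is bounded. -/
theorem SyncLocal.output_apply_eq_one {f : Cantor d n ≃ₜ Cantor d n} {k : ℕ}
    (hk : SyncLocal f k) {s t : Words d n} (hs : Deep k s) (ht : Deep k t) {i c : Fin d}
    (h : ¬ Grows f s i c) {l : Words d n} (hl : l ∈ wordsOn d n {i}) : output f t l c = 1 := by
  simp only [Grows, not_forall, not_exists, not_and, not_le] at h
  obtain ⟨B, hB⟩ := h
  set a : Words d n := Pi.mulSingle i (t i) with ha
  set r : Words d n := Function.update t i 1 with hr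
  have hat : a * r = t := mulSingle_mul_update i t
  have ha_on : a ∈ wordsOn d n {i} := mulSingle_mem_wordsOn _ _
  have hri : r i = 1 := by simp [hr]
  -- After `l`, reading the `i`-th coordinate `a` of `t` again returns to the state `t`.
  have hloop : t * (l * a) = a * l * t := by
    rw [← hat, mul_assoc a r, ← mul_assoc r l a, ← (commute_of_mem_wordsOn hl hri).eq,
      mul_assoc l r a, ← (commute_of_mem_wordsOn ha_on hri).eq, mul_assoc]
  have hsa : Deep k (Function.update s i 1 * a) := fun j => by
    rcases eq_or_ne j i with rfl | hj
    · simpa [ha] using ht j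
    · simpa [ha, hj] using hs j
  -- The state is independent of `N`: coordinate `i` ends in the deep word `a`, and the other
  -- coordinates are those of `s`.
  have hstate : ∀ N, localMap f (s * (a * (l * a) ^ N)) =
      localMap f (Function.update s i 1 * a) := by
    intro N
    have h1 : a * (l * a) ^ N = (a * l) ^ N * a :=
      (show SemiconjBy a (l * a) (a * l) from (mul_assoc a l a).symm).pow_right N
    have hcomm := (commute_of_mem_wordsOn (pow_mem_wordsOn (mul_mem_wordsOn ha_on hl) N)
      (Function.update_self i 1 s)).eq
    rw [h1]
    conv_lhs => rw [← mulSingle_mul_update i s]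
    rw [mul_assoc, ← mul_assoc (Function.update s i 1), ← hcomm, mul_assoc, ← mul_assoc,
      hk.localMap_mul _ hsa]
  -- The output of `s` on `t * (l * a) ^ N = a * (l * a) ^ N * r` is computed twice: the left form
  -- contains `N` copies of the loop output; the right form is at most `B`, plus the output on `r`
  -- from a fixed state.
  have hlen : ∀ N, N * (output f t (l * a) c).length ≤
      B + (output f (Function.update s i 1 * a) r c).length := by
    intro N
    have h1 : t * (l * a) ^ N = a * (l * a) ^ N * r := by
      rw [← hat, mul_assoc, mul_assoc,
        (commute_of_mem_wordsOn (pow_mem_wordsOn (mul_mem_wordsOn hl ha_on) N) hri).eq]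
    have h2 := output_mul f s t ((l * a) ^ N)
    rw [output_congr (hk.localMap_mul s ht), hk.output_pow ht hloop, h1, output_mul,
      output_congr (hstate N)] at h2
    have h3 := congrArg FreeMonoid.length (congrFun h2 c)
    have h4 := hB _ (mul_mem_wordsOn ha_on (pow_mem_wordsOn (mul_mem_wordsOn hl ha_on) N))
    have h5 : ∀ (w : FreeMonoid (Fin n)) (N : ℕ), (w ^ N).length = N * w.length := by
      intro w N
      induction N with
      | zero => simp
      | succ N ih => rw [pow_succ, FreeMonoid.length_mul, ih, Nat.succ_mul]
    simp only [Pi.mul_apply, Pi.pow_apply, FreeMonoid.length_mul, h5] at h3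
    omega
  have hzero : (output f t (l * a) c).length = 0 := by
    by_contra hne
    have h1 := hlen (B + (output f (Function.update s i 1 * a) r c).length + 1)
    have h2 := Nat.le_mul_of_pos_right
      (B + (output f (Function.update s i 1 * a) r c).length + 1) (Nat.pos_of_ne_zero hne)
    omega
  rw [output_mul, Pi.mul_apply, FreeMonoid.length_mul] at hzero
  exact FreeMonoid.length_eq_zero.mp (by omega)

theorem exists_deep_and_deep_imagePrefix (f : Cantor d n ≃ₜ Cantor d n) (k : ℕ) :
    ∃ s, Deep k s ∧ Deep k (imagePrefix f s) := by
  obtain ⟨M, hM⟩ := exists_deep_imagePrefix f k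
  obtain ⟨s, hs⟩ := exists_deep (n := n) d (k + M)
  exact ⟨s, hs.mono (by omega), hM s (hs.mono (by omega))⟩

/-- The value `ψ i` is the coordinate that grows. Injectivity makes `ψ` bijective, so a coordinate
other than `ψ i` grows from another input coordinate, hence not from `i`, and receives no output
from it. -/
theorem SyncLocal.exists_coreCoordMap {f : Cantor d n ≃ₜ Cantor d n} {k : ℕ}
    (hf : SyncLocal f k) (hg : SyncLocal f.symm k) :
    ∃ ψ : Equiv.Perm (Fin d), CoreCoordMap f ψ ∧ ∀ ψ', CoreCoordMap f ψ' → ψ' = ψ := by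
  obtain ⟨s, hs, hfs⟩ := exists_deep_and_deep_imagePrefix f k
  choose ψ hψ using hf.exists_grows hs
  have hinj : Function.Injective ψ := fun i i' h =>
    hg.eq_of_grows hfs (hψ i) (h ▸ hψ i')
  have hbij := Finite.injective_iff_bijective.mp hinj
  refine ⟨Equiv.ofBijective ψ hbij, ?_, fun ψ' h => funext fun i => ?_⟩
  · intro i o ho l hl c hc
    rw [hf.coreOut_eq le_rfl] at ho
    obtain ⟨t, ht, rfl⟩ := ho
    obtain ⟨i', rfl⟩ := hbij.surjective c
    refine hf.output_apply_eq_one hs ht (fun hgr => hc ?_) hl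
    rw [hg.eq_of_grows hfs hgr (hψ i')]
    rfl
  · obtain ⟨l, hl, h1⟩ := hψ i 1
    by_contra hne
    have h2 := h i (output f s) (by rw [hf.coreOut_eq le_rfl]; exact ⟨s, hs, rfl⟩) l hl (ψ i)
      fun h => hne h.symm
    simp [h2] at h1

/-- If `χ i ≠ ψ' (ψ i)`, reading in coordinate `i` lengthens the words passed to `g` without bound,
while the image prefixes under `g` stay bounded: outside `ψ' (ψ i)` because `g` writes nothing
there, and at `ψ' (ψ i)` because they divide the prefix of the composite, which is constant there.
This contradicts finiteness for `g`. -/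
theorem SyncLocal.coreCoordMap_trans {f g : Cantor d n ≃ₜ Cantor d n} {k : ℕ}
    (hf : SyncLocal f k) (hg : SyncLocal g k) (hfg : SyncLocal (f.trans g) k)
    {ψ ψ' χ : Fin d → Fin d} (hψ : CoreCoordMap f ψ) (hψ' : CoreCoordMap g ψ')
    (hχ : CoreCoordMap (f.trans g) χ) : χ = ψ' ∘ ψ := by
  obtain ⟨s, hs, hfs⟩ := exists_deep_and_deep_imagePrefix f k
  funext i
  by_contra hne
  have hmem : ∀ {h : Cantor d n ≃ₜ Cantor d n}, SyncLocal h k → ∀ {t}, Deep k t →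
      output h t ∈ coreOut h := fun hh t ht => by
    rw [hh.coreOut_eq le_rfl]
    exact ⟨t, ht, rfl⟩
  obtain ⟨B, hB⟩ := exists_forall_length_le (hg.finite_imagePrefix_le fun c =>
    (imagePrefix g (imagePrefix f s) c).length + (imagePrefix (f.trans g) s c).length)
  obtain ⟨l, hl, c, hc⟩ := hf.exists_lt_length_imagePrefix hs i fun _ => B
  refine absurd (hB (imagePrefix f (s * l)) ⟨?_, fun j => ?_⟩ c) (not_le.mpr hc)
  · rw [imagePrefix_mul]
    exact hfs.mul_right _
  · rcases eq_or_ne j (ψ' (ψ i)) with rfl | hj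
    · refine (length_le_of_dvd (pi_dvd_iff.mp
        (imagePrefix_dvd_trans f g (s * l)) _)).trans ?_
      rw [imagePrefix_mul, Pi.mul_apply, show output (f.trans g) s l (ψ' (ψ i)) = 1 from
        hχ i _ (hmem hfg hs) l hl _ fun h => hne h.symm, mul_one]
      exact Nat.le_add_left _ _
    · rw [imagePrefix_mul, imagePrefix_mul, Pi.mul_apply,
        hψ' _ _ (hmem hg hfs) _ (hψ i _ (hmem hf hs) l hl) j hj, mul_one]
      exact Nat.le_add_right _ _

end CoordMap

/-! ### Renaming coordinates as conjugation by coordinate permutations. -/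

section Permute

variable {d n : ℕ}

/-- Renaming of the coordinates of input and output of a function on words. -/
def permuteFun (σ : Equiv.Perm (Fin d)) (o : Words d n → Words d n) : Words d n → Words d n :=
  fun w => o (w ∘ σ) ∘ σ.symm

theorem permuteFun_injective (σ : Equiv.Perm (Fin d)) :
    Function.Injective (permuteFun (n := n) σ) := by
  intro o o' h
  funext w i
  have h1 := congrFun (congrFun h (w ∘ σ.symm)) (σ i)
  have h2 : (w ∘ σ.symm) ∘ σ = w := funext fun j => by simp
  simpa [permuteFun, h2] using h1

/-- The conjugate of `f` by a permutation of the coordinates. -/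
def conjPerm (σ : Equiv.Perm (Fin d)) (f : Cantor d n ≃ₜ Cantor d n) :
    Cantor d n ≃ₜ Cantor d n :=
  (permHomeo n σ).trans (f.trans (permHomeo n σ⁻¹))

/-- Permuting the free coordinates of the input first does not change the set of values, so the
longest common prefixes agree. -/
theorem imagePrefix_conjPerm (σ : Equiv.Perm (Fin d)) (f : Cantor d n ≃ₜ Cantor d n)
    (s : Words d n) :
    imagePrefix (conjPerm σ f) s = imagePrefix f (s ∘ σ) ∘ σ.symm :=
  funext fun i => congrArg lcp ((permHomeo n σ).surjective.range_comp
    fun x => f (consPt (s ∘ σ) x) (σ.symm i))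

variable [n.AtLeastTwo]

theorem output_conjPerm (σ : Equiv.Perm (Fin d)) (f : Cantor d n ≃ₜ Cantor d n)
    (s : Words d n) : output (conjPerm σ f) s = permuteFun σ (output f (s ∘ σ)) := by
  funext w
  have h := imagePrefix_mul (conjPerm σ f) s w
  have h2 : (s * w) ∘ σ = (s ∘ σ) * (w ∘ σ) := rfl
  rw [imagePrefix_conjPerm, imagePrefix_conjPerm, h2, imagePrefix_mul] at h
  exact (mul_left_cancel h).symm

theorem coreOut_conjPerm (σ : Equiv.Perm (Fin d)) (f : Cantor d n ≃ₜ Cantor d n) :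
    coreOut (conjPerm σ f) = permuteFun σ '' coreOut f := by
  have hσ : ∀ p : Words d n, (p ∘ σ.symm) ∘ σ = p := fun p => funext fun j => by simp
  ext o
  constructor
  · rintro ⟨w, hw⟩
    refine ⟨output f (w ∘ σ), ⟨w ∘ σ, fun p => permuteFun_injective σ ?_⟩, ?_⟩
    · have h1 := (hw (p ∘ σ.symm)).trans (hw 1).symm
      rw [output_conjPerm, output_conjPerm, one_mul] at h1
      rw [← h1]
      exact congrArg (fun q => permuteFun σ (output f (q * (w ∘ σ)))) (hσ p).symm
    · rw [← hw 1, output_conjPerm, one_mul]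
  · rintro ⟨o, ⟨w, hw⟩, rfl⟩
    refine ⟨w ∘ σ.symm, fun p => ?_⟩
    rw [output_conjPerm, ← hw (p ∘ σ)]
    exact congrArg (fun q => permuteFun σ (output f ((p ∘ σ) * q))) (hσ w)

theorem mk_permute_eq_coreClass {T : DNTransducer d n} {f : Cantor d n ≃ₜ Cantor d n}
    (h : Quotient.mk (strongIsoSetoid d n) T = coreClass f) (σ : Equiv.Perm (Fin d)) :
    Quotient.mk (strongIsoSetoid d n) (T.permute σ) = coreClass (conjPerm σ f) := by
  obtain ⟨hinj, hrange⟩ := mk_eq_coreClass_iff.mp h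
  have e : (T.permute σ).out = permuteFun σ ∘ T.out := rfl
  rw [mk_eq_coreClass_iff, e]
  refine ⟨(permuteFun_injective σ).comp hinj, ?_⟩
  rw [coreOut_conjPerm, ← hrange]
  exact Set.range_comp _ T.out

theorem output_permHomeo (σ : Equiv.Perm (Fin d)) (s l : Words d n) :
    output (permHomeo n σ) s l = l ∘ σ := by
  rw [output, localMap_permHomeo]
  exact imagePrefix_permHomeo σ l

theorem permHomeo_mem_syncHomeos (σ : Equiv.Perm (Fin d)) :
    permHomeo n σ ∈ syncHomeos d n :=
  mem_syncHomeos_iff.mpr ⟨0, fun _ _ _ _ => by rw [localMap_permHomeo, localMap_permHomeo]⟩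

theorem permHomeo_mem_unitHomeos (σ : Equiv.Perm (Fin d)) :
    permHomeo n σ ∈ unitHomeos d n :=
  mem_unitHomeos_iff.mpr ⟨permHomeo_mem_syncHomeos σ, permHomeo_mem_syncHomeos σ⁻¹⟩

/-- The output on `l` is `l ∘ σ`, whose `j`-th coordinate comes from coordinate `σ j`; this is why
the inverse appears. -/
theorem coreCoordMap_permHomeo (σ : Equiv.Perm (Fin d)) :
    CoreCoordMap (permHomeo n σ) σ.symm := by
  rintro i _ ⟨w, hw⟩ l hl j hj
  rw [← hw 1, output_permHomeo]
  exact hl _ fun h => hj (σ.eq_symm_apply.mpr h)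

end Permute

/-! ### The group `d𝒪_{n,1}`, its map to the symmetric group, and the kernel. -/

section Outer

variable {d n : ℕ} [n.AtLeastTwo]

theorem isCoordMap_iff {T : DNTransducer d n} {f : Cantor d n ≃ₜ Cantor d n}
    (h : Quotient.mk (strongIsoSetoid d n) T = coreClass f) (ψ : Fin d → Fin d) :
    T.IsCoordMap ψ ↔ CoreCoordMap f ψ := by
  rw [CoreCoordMap, ← (mk_eq_coreClass_iff.mp h).2]
  simp only [Set.forall_mem_range]
  rfl

theorem exists_coreCoordMap {f : Cantor d n ≃ₜ Cantor d n} (hf : f ∈ unitHomeos d n) :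
    ∃ ψ : Equiv.Perm (Fin d), CoreCoordMap f ψ ∧ ∀ ψ', CoreCoordMap f ψ' → ψ' = ψ := by
  rw [mem_unitHomeos_iff] at hf
  obtain ⟨k, hk⟩ := exists_syncLocal (S := {f, f.symm})
    (by rintro _ (rfl | rfl); exacts [hf.1, hf.2]) (Set.toFinite _)
  exact (hk f (by simp)).exists_coreCoordMap (hk f.symm (by simp))

theorem existsUnique_isCoordMap {T : DNTransducer d n}
    (h : Quotient.mk (strongIsoSetoid d n) T ∈ outerClasses d n) :
    ∃! ψ : Fin d → Fin d, T.IsCoordMap ψ := by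
  obtain ⟨f, hf, e⟩ := h
  obtain ⟨ψ, h1, h2⟩ := exists_coreCoordMap hf
  exact ⟨ψ, (isCoordMap_iff e _).mpr h1, fun ψ' h' => h2 ψ' ((isCoordMap_iff e _).mp h')⟩

theorem coreCoordMap_trans {f g : Cantor d n ≃ₜ Cantor d n} (hf : f ∈ unitHomeos d n)
    (hg : g ∈ unitHomeos d n) {ψ ψ' : Fin d → Fin d} (hψ : CoreCoordMap f ψ)
    (hψ' : CoreCoordMap g ψ') : CoreCoordMap (f.trans g) (ψ' ∘ ψ) := by
  obtain ⟨χ, hχ, -⟩ := exists_coreCoordMap (trans_mem_unitHomeos hf hg)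
  obtain ⟨k, hk⟩ := exists_syncLocal (S := {f, g, f.trans g})
    (by rintro _ (rfl | rfl | rfl); exacts [hf.1, hg.1, trans_mem_syncHomeos hf.1 hg.1])
    (Set.toFinite _)
  have h := (hk f (by simp)).coreCoordMap_trans (hk g (by simp)) (hk _ (by simp)) hψ hψ' hχ
  rwa [← h]

/-- The class of the core of `M_f` as an element of `d𝒪_{n,1}`. -/
noncomputable def outerClass (f : Cantor d n ≃ₜ Cantor d n) (hf : f ∈ unitHomeos d n) :
    outerClasses d n :=
  ⟨coreClass f, f, hf, rfl⟩

/-- A homeomorphism representing an element of `d𝒪_{n,1}`. -/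
noncomputable def outerRep (a : outerClasses d n) : Cantor d n ≃ₜ Cantor d n := a.2.choose

theorem outerRep_mem (a : outerClasses d n) : outerRep a ∈ unitHomeos d n :=
  a.2.choose_spec.1

theorem coreClass_outerRep (a : outerClasses d n) : coreClass (outerRep a) = a.1 :=
  a.2.choose_spec.2.symm

theorem outerClass_outerRep (a : outerClasses d n) :
    outerClass (outerRep a) (outerRep_mem a) = a := Subtype.ext (coreClass_outerRep a)

/-- The multiplication of `d𝒪_{n,1}`, given by composition of homeomorphisms. -/
@[reducible] noncomputable def outerMul : Mul (outerClasses d n) :=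
  ⟨fun a b => outerClass ((outerRep a).trans (outerRep b))
    (trans_mem_unitHomeos (outerRep_mem a) (outerRep_mem b))⟩

attribute [local instance] outerMul

/-- The class of the identity. -/
@[reducible] noncomputable def outerOne : One (outerClasses d n) :=
  ⟨outerClass (permHomeo n 1) (permHomeo_mem_unitHomeos 1)⟩

attribute [local instance] outerOne

/-- Inversion in `d𝒪_{n,1}`. -/
@[reducible] noncomputable def outerInv : Inv (outerClasses d n) :=
  ⟨fun a => outerClass (outerRep a).symm (symm_mem_unitHomeos (outerRep_mem a))⟩

attribute [local instance] outerInv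

theorem outerClass_mul {f g : Cantor d n ≃ₜ Cantor d n} (hf : f ∈ unitHomeos d n)
    (hg : g ∈ unitHomeos d n) : outerClass f hf * outerClass g hg =
      outerClass (f.trans g) (trans_mem_unitHomeos hf hg) :=
  Subtype.ext (coreClass_trans_congr (outerRep_mem _).1 (outerRep_mem _).1 hf.1 hg.1
    (coreClass_outerRep _) (coreClass_outerRep _))

/-- The group `d𝒪_{n,1}`. -/
@[reducible] noncomputable def outerGroup : Group (outerClasses d n) :=
  Group.ofLeftAxioms
    (fun a b c => by
      rw [← outerClass_outerRep a, ← outerClass_outerRep b, ← outerClass_outerRep c]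
      simp only [outerClass_mul]
      rfl)
    (fun a => by
      conv_lhs => rw [← outerClass_outerRep a]
      refine (outerClass_mul _ _).trans ?_
      exact outerClass_outerRep a)
    (fun a => by
      conv_lhs => rw [← outerClass_outerRep (a⁻¹ * a)]
      rw [outerClass_outerRep]
      conv_lhs =>
        arg 2
        rw [← outerClass_outerRep a]
      refine (outerClass_mul _ _).trans (Subtype.ext ?_)
      change coreClass ((outerRep a).symm.trans (outerRep a)) = _
      rw [Homeomorph.symm_trans_self]
      rfl)

attribute [local instance] outerGroup

/-- The map `ψ_T` of an element of `d𝒪_{n,1}`, as a permutation. -/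
noncomputable def coordPerm (a : outerClasses d n) : Equiv.Perm (Fin d) :=
  (exists_coreCoordMap (outerRep_mem a)).choose

theorem coreCoordMap_coordPerm (a : outerClasses d n) :
    CoreCoordMap (outerRep a) (coordPerm a) :=
  (exists_coreCoordMap (outerRep_mem a)).choose_spec.1

theorem coordPerm_outerClass {f : Cantor d n ≃ₜ Cantor d n} (hf : f ∈ unitHomeos d n)
    {ψ : Fin d → Fin d} : coordPerm (outerClass f hf) = ψ ↔ CoreCoordMap f ψ := by
  have h1 := coreCoordMap_coordPerm (outerClass f hf)
  obtain ⟨χ, -, h2⟩ := exists_coreCoordMap hf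
  have e : coreOut (outerRep (outerClass f hf)) = coreOut f :=
    coreClass_eq_iff.mp (coreClass_outerRep _)
  rw [CoreCoordMap, e] at h1
  exact ⟨fun h => h ▸ h1, fun h => (h2 _ h1).trans (h2 _ h).symm⟩

/-- Homeomorphisms compose from left to right and permutations as functions, so the order reverses;
`coordHom` corrects this by inverting. -/
theorem coordPerm_mul (a b : outerClasses d n) :
    coordPerm (a * b) = coordPerm b * coordPerm a := by
  obtain ⟨f, hf, rfl⟩ : ∃ f hf, outerClass f hf = a := ⟨_, _, outerClass_outerRep a⟩
  obtain ⟨g, hg, rfl⟩ : ∃ g hg, outerClass g hg = b := ⟨_, _, outerClass_outerRep b⟩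
  apply DFunLike.coe_injective
  rw [Equiv.Perm.coe_mul, outerClass_mul, coordPerm_outerClass]
  have h1 := (coordPerm_outerClass hf).mp rfl
  have h2 := (coordPerm_outerClass hg).mp rfl
  exact coreCoordMap_trans hf hg h1 h2

/-- The permutation of the coordinates inverse to `ψ_T`, as a homomorphism. -/
noncomputable def coordHom (d n : ℕ) [n.AtLeastTwo] :
    outerClasses d n →* Equiv.Perm (Fin d) :=
  MonoidHom.mk' (fun a => (coordPerm a)⁻¹) fun a b => by rw [coordPerm_mul, mul_inv_rev]

/-- The classes of the homeomorphisms permuting the coordinates. -/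
noncomputable def permHom (d n : ℕ) [n.AtLeastTwo] :
    Equiv.Perm (Fin d) →* outerClasses d n :=
  MonoidHom.mk' (fun σ => outerClass (permHomeo n σ) (permHomeo_mem_unitHomeos σ)) fun σ τ => by
    -- No inverse is needed here: `(p ∘ σ) ∘ τ = p ∘ (σ * τ)`.
    rw [outerClass_mul]
    rfl

theorem coordHom_permHom (σ : Equiv.Perm (Fin d)) : coordHom d n (permHom d n σ) = σ := by
  have h : coordPerm (permHom d n σ) = σ.symm := DFunLike.coe_injective
    ((coordPerm_outerClass (permHomeo_mem_unitHomeos σ)).mpr (coreCoordMap_permHomeo σ))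
  change (coordPerm (permHom d n σ))⁻¹ = σ
  rw [h]
  rfl

/-- Since the coordinate map is unique, the choice made in `coordMap` returns it for every
representative `T`, so the condition does not depend on `T`. -/
theorem mem_ker_coordHom {a : outerClasses d n} :
    a ∈ (coordHom d n).ker ↔ a.1 ∈ coordIdClasses d n := by
  obtain ⟨f, hf, rfl⟩ : ∃ f hf, outerClass f hf = a := ⟨_, _, outerClass_outerRep a⟩
  have h1 : outerClass f hf ∈ (coordHom d n).ker ↔ CoreCoordMap f id := by
    rw [← coordPerm_outerClass hf, MonoidHom.mem_ker]
    exact inv_eq_one.trans ⟨fun h => by rw [h]; rfl, fun h => DFunLike.coe_injective h⟩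
  have h2 : ∀ T : DNTransducer d n, Quotient.mk (strongIsoSetoid d n) T = coreClass f →
      (T.coordMap = id ↔ CoreCoordMap f id) := by
    intro T hT
    obtain ⟨ψ, hψ, huniq⟩ := existsUnique_isCoordMap (T := T) ⟨f, hf, hT⟩
    have hspec : T.IsCoordMap T.coordMap :=
      @Classical.epsilon_spec_aux _ ⟨id⟩ T.IsCoordMap ⟨ψ, hψ⟩
    rw [← isCoordMap_iff hT]
    exact ⟨fun h => h ▸ hspec, fun h => (huniq _ hspec).trans (huniq _ h).symm⟩
  rw [h1]
  constructor
  · exact fun h => ⟨⟨f, hf, rfl⟩, (minTransducer f).core, rfl, (h2 _ rfl).mpr h⟩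
  · rintro ⟨-, T, hT, hid⟩
    exact (h2 T hT).mp hid

/-- This identifies the conjugation action of the split extension with the renaming of coordinates.
-/
theorem permHom_conj_eq_mk_permute (σ : Equiv.Perm (Fin d)) (a : outerClasses d n)
    {T : DNTransducer d n} (hT : Quotient.mk (strongIsoSetoid d n) T = a.1) :
    (permHom d n σ * a * (permHom d n σ)⁻¹).1 =
      Quotient.mk (strongIsoSetoid d n) (T.permute σ) := by
  rw [← coreClass_outerRep] at hT
  rw [mk_permute_eq_coreClass hT]
  conv_lhs => rw [← outerClass_outerRep a]
  rw [← map_inv, mul_assoc]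
  have e : ∀ τ, permHom d n τ = outerClass (permHomeo n τ) (permHomeo_mem_unitHomeos τ) :=
    fun _ => rfl
  rw [e, e, outerClass_mul, outerClass_mul]
  rfl

end Outer

/-! ### Split extensions as semidirect products. -/

section Split

variable {G H : Type*} [Group G] [Group H]

/-- The action of the quotient of a split extension on the kernel. -/
def splitAction (χ : G →* H) (S : H →* G) : H →* MulAut χ.ker :=
  MulAut.conjNormal.comp S

/-- A split extension is a semidirect product. -/
noncomputable def splitEquiv (χ : G →* H) (S : H →* G) (hS : ∀ h, χ (S h) = h) :
    χ.ker ⋊[splitAction χ S] H ≃* G :=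
  MulEquiv.ofBijective
    (SemidirectProduct.lift χ.ker.subtype S fun _ => MonoidHom.ext fun _ => rfl) <| by
    constructor
    · rw [injective_iff_map_eq_one]
      intro x hx
      have h1 : (x.left : G) * S x.right = 1 := hx
      have h2 : x.right = 1 := by
        have h3 := congrArg χ h1
        rwa [map_mul, hS, MonoidHom.mem_ker.mp x.left.2, one_mul, map_one] at h3
      rw [h2, map_one, mul_one] at h1
      exact SemidirectProduct.ext (Subtype.ext h1) h2
    · intro g
      -- Dividing `g` by the lift of its image leaves an element of the kernel.
      refine ⟨⟨⟨g * (S (χ g))⁻¹, ?_⟩, χ g⟩, inv_mul_cancel_right g _⟩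
      rw [MonoidHom.mem_ker, map_mul, map_inv, hS, mul_inv_cancel]

theorem splitEquiv_inl (χ : G →* H) (S : H →* G) (hS : ∀ h, χ (S h) = h) (k : χ.ker) :
    splitEquiv χ S hS (SemidirectProduct.inl k) = k :=
  SemidirectProduct.lift_inl _ S (fun _ => MonoidHom.ext fun _ => rfl) k

theorem splitEquiv_inr (χ : G →* H) (S : H →* G) (hS : ∀ h, χ (S h) = h) (h : H) :
    splitEquiv χ S hS (SemidirectProduct.inr h) = S h :=
  SemidirectProduct.lift_inr _ S (fun _ => MonoidHom.ext fun _ => rfl) h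

end Split

end BrinThompson

theorem mainTheorem6 (d n : ℕ) [n.AtLeastTwo] :
    -- the synchronizing homeomorphisms are closed under composition
    (∀ f ∈ BrinThompson.syncHomeos d n, ∀ g ∈ BrinThompson.syncHomeos d n,
      f.trans g ∈ BrinThompson.syncHomeos d n) ∧
    -- the coordinate map of every transducer representing an element is well defined
    (∀ T : BrinThompson.DNTransducer d n,
      Quotient.mk (BrinThompson.DNTransducer.strongIsoSetoid d n) T ∈
        BrinThompson.outerClasses d n →
      ∃! ψ : Fin d → Fin d, T.IsCoordMap ψ) ∧
    -- the group structure given by composition of homeomorphisms, from left to right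
    ∃ _ : Group (BrinThompson.outerClasses d n),
      (∀ a b : BrinThompson.outerClasses d n,
        ∀ f ∈ BrinThompson.unitHomeos d n, ∀ g ∈ BrinThompson.unitHomeos d n,
        a.1 = BrinThompson.coreClass f → b.1 = BrinThompson.coreClass g →
        (a * b).1 = BrinThompson.coreClass (f.trans g)) ∧
      ∃ K : Subgroup (BrinThompson.outerClasses d n),
        (∀ a : BrinThompson.outerClasses d n, a ∈ K ↔ a.1 ∈ BrinThompson.coordIdClasses d n) ∧
        -- the action of the symmetric group by permuting coordinates
        ∃ φ : Equiv.Perm (Fin d) →* MulAut K,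
          (∀ (σ : Equiv.Perm (Fin d)) (k : K) (T : BrinThompson.DNTransducer d n),
            Quotient.mk (BrinThompson.DNTransducer.strongIsoSetoid d n) T = k.1.1 →
            (φ σ k).1.1 =
              Quotient.mk (BrinThompson.DNTransducer.strongIsoSetoid d n) (T.permute σ)) ∧
          ∃ Θ : (K ⋊[φ] Equiv.Perm (Fin d)) ≃* BrinThompson.outerClasses d n,
            (∀ k : K, Θ (SemidirectProduct.inl k) = k.1) ∧
            (∀ σ : Equiv.Perm (Fin d), BrinThompson.permHomeo n σ ∈ BrinThompson.unitHomeos d n ∧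
              (Θ (SemidirectProduct.inr σ)).1 =
                BrinThompson.coreClass (BrinThompson.permHomeo n σ)) := by
  let _ : Group (BrinThompson.outerClasses d n) := BrinThompson.outerGroup
  open BrinThompson in
  refine ⟨fun f hf g hg => trans_mem_syncHomeos hf hg, fun T => existsUnique_isCoordMap,
    inferInstance, ?_, (coordHom d n).ker, fun _ => mem_ker_coordHom,
    splitAction (coordHom d n) (permHom d n), ?_,
    splitEquiv (coordHom d n) (permHom d n) coordHom_permHom, splitEquiv_inl _ _ _,
    fun σ => ⟨permHomeo_mem_unitHomeos σ, ?_⟩⟩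
  · rintro ⟨_, _⟩ ⟨_, _⟩ f hf g hg rfl rfl
    exact congrArg Subtype.val (outerClass_mul hf hg)
  · exact fun σ k T hT => permHom_conj_eq_mk_permute σ k.1 hT
  · rw [splitEquiv_inr]
    rfl
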